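/- Let $k$ be a commutative ring and let $\mathcal B$ be a $k$-linear abelian category with enough projectives. Let $Q=(Q_0,Q_1,s,t)$ be a (not necessarily finite) quiver which is locally bounded, i.e. for each vertex $i\in Q_0$ there are only finitely many paths starting in $i$ and only finitely many paths ending in $i$. Let $kQ$ be the $k$-linearization of $Q$, that is, the category with object set $Q_0$ whose morphisms are the $k$-linear combinations of paths, and let $\mathcal B^{kQ}$ be the abelian category of $k$-linear functors $kQ\to\mathcal B$ (representations $F=(F(i),f_\alpha)_{i\in Q_0,\,\alpha\in Q_1}$ of $Q$ over $\mathcal B$, where $f_\alpha\colon F(s(\alpha))\to F(t(\alpha))$). For $F\in\mathcal B^{kQ}$ and $i\in Q_0$ consider the morphism $$(f_\alpha)_{t(\alpha)=i}\colon \bigoplus_{t(\alpha)=i}F(s(\alpha))\to F(i),$$ and call $F$ monic if this is a monomorphism for all $i\in Q_0$. An object $A$ of an abelian category $\mathcal A$ is called Gorenstein projective if there is an acyclic complex $Q_\bullet=\cdots\to Q_1\xrightarrow{f_1}Q_0\xrightarrow{f_0}Q_{-1}\to\cdots$ of projective objects of $\mathcal A$ such that $\mathcal A(Q_\bullet,P)$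 is acyclic for every projective object $P$ of $\mathcal A$, and such that $A\cong\operatorname{Ker} f_0$. Then the following hold. 1. A representation $F\in\mathcal B^{kQ}$ is Gorenstein projective in $\mathcal B^{kQ}$ if and only if $F$ is monic and, for every $i\in Q_0$, the cokernel of $(f_\alpha)_{t(\alpha)=i}\colon \bigoplus_{t(\alpha)=i}F(s(\alpha))\to F(i)$ is Gorenstein projective in $\mathcal B$. 2. If $F\in\mathcal B^{kQ}$ is Gorenstein projective in $\mathcal B^{kQ}$, then $F(i)$ is Gorenstein projective in $\mathcal B$ for every $i\in Q_0$. -/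

import Mathlib

open CategoryTheory CategoryTheory.Limits

universe w v u v₁ u₁ v₂ u₂

noncomputable section

/-- A (possibly infinite) quiver is locally bounded if, for every vertex `i`, only finitely many
paths (including the trivial one) start in `i` and only finitely many paths end in `i`. -/
class LocallyBoundedQuiver (V : Type u₁) [Quiver.{v₁} V] : Prop where
  finite_paths_from : ∀ i : V, Finite (Σ j : V, Quiver.Path i j)
  finite_paths_to : ∀ i : V, Finite (Σ j : V, Quiver.Path j i)

/-- In a locally bounded quiver every vertex is the target of only finitely many arrows. -/
instance LocallyBoundedQuiver.finite_costar (V : Type u₁) [Quiver.{v₁} V]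
    [LocallyBoundedQuiver V] (i : V) : Finite (Quiver.Costar i) := by
  have := LocallyBoundedQuiver.finite_paths_to i
  refine Finite.of_injective
    (fun a : Quiver.Costar i => (⟨a.1, a.2.toPath⟩ : Σ j : V, Quiver.Path j i)) ?_
  rintro ⟨j, a⟩ ⟨j', a'⟩ h
  obtain ⟨rfl, h⟩ := Sigma.mk.inj h
  have := Quiver.Path.hom_heq_of_cons_eq_cons (eq_of_heq h)
  simpa using this

section Gorenstein

variable {A : Type u} [Category.{v} A] [Abelian A]

/-- A complex `⋯ ⟶ Q₁ ⟶ Q₀ ⟶ Q₋₁ ⟶ ⋯` is totally acyclic if it is acyclic, consists of projective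
objects, and stays acyclic after applying `Hom(-, P)` for every projective object `P`. The last
condition says that every `f : Qₙ ⟶ P` which vanishes on composition with `Qₙ₊₁ ⟶ Qₙ` factors
through `Qₙ ⟶ Qₙ₋₁`. -/
structure IsTotallyAcyclic (K : ChainComplex A ℤ) : Prop where
  projective : ∀ n : ℤ, Projective (K.X n)
  acyclic : K.Acyclic
  hom_acyclic : ∀ (P : A), Projective P → ∀ (n : ℤ) (f : K.X n ⟶ P),
    K.d (n + 1) n ≫ f = 0 → ∃ g : K.X (n - 1) ⟶ P, K.d n (n - 1) ≫ g = f

/-- An object is Gorenstein projective if it is the kernel `Z₀` of `Q₀ ⟶ Q₋₁` for a totally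
acyclic complex `Q`. -/
def IsGorensteinProjective (X : A) : Prop :=
  ∃ (K : ChainComplex A ℤ) (_ : IsTotallyAcyclic K) (ι : X ⟶ K.X 0) (w : ι ≫ K.d 0 (-1) = 0),
    Nonempty (IsLimit (KernelFork.ofι ι w))

end Gorenstein

section Representations

/-- The property of being a `k`-linear functor between `k`-linear categories. -/
def isLinearFunctor (k : Type w) [CommRing k] (C : Type u₁) [Category.{v₁} C] [Preadditive C]
    [Linear k C] (B : Type u₂) [Category.{v₂} B] [Preadditive B] [Linear k B] :
    ObjectProperty (C ⥤ B) :=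
  fun F => F.Additive ∧ F.Linear k

/-- The category `B^C` of `k`-linear functors `C ⥤ B` and all natural transformations. -/
abbrev LinearFunctorCategory (k : Type w) [CommRing k] (C : Type u₁) [Category.{v₁} C]
    [Preadditive C] [Linear k C] (B : Type u₂) [Category.{v₂} B] [Preadditive B] [Linear k B] :=
  (isLinearFunctor k C B).FullSubcategory

section Abelian

open scoped ZeroObject

variable {k : Type w} [CommRing k] {C : Type u₁} [Category.{v₁} C] [Preadditive C] [Linear k C]
  {B : Type u₂} [Category.{v₂} B] [Abelian B] [Linear k B]

/-- This and the following three instances make `LinearFunctorCategory k C B` an abelian category,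
with the pointwise structure. -/
instance isLinearFunctor_closedUnderSubobjects :
    (isLinearFunctor k C B).IsClosedUnderSubobjects where
  prop_of_mono {F G} φ _ hG := by
    obtain ⟨_, _⟩ := hG
    refine ⟨⟨fun {X Y f g} => ?_⟩, ⟨fun {X Y} f r => ?_⟩⟩
    · simp [← cancel_mono (φ.app Y)]
    · simp [← cancel_mono (φ.app Y)]

instance isLinearFunctor_closedUnderQuotients :
    (isLinearFunctor k C B).IsClosedUnderQuotients where
  prop_of_epi {F G} φ _ hF := by
    obtain ⟨_, _⟩ := hF
    refine ⟨⟨fun {X Y f g} => ?_⟩, ⟨fun {X Y} f r => ?_⟩⟩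
    · simp [← cancel_epi (φ.app X), ← NatTrans.naturality]
    · simp [← cancel_epi (φ.app X), ← NatTrans.naturality]

instance isLinearFunctor_containsZero : (isLinearFunctor k C B).ContainsZero where
  exists_zero := ⟨(Functor.const C).obj 0,
    Functor.isZero _ fun _ => isZero_zero B,
    ⟨⟨fun {_ _ _ _} => (isZero_zero B).eq_of_src _ _⟩,
      ⟨fun _ _ => (isZero_zero B).eq_of_src _ _⟩⟩⟩

instance isLinearFunctor_closedUnderFiniteProducts :
    (isLinearFunctor k C B).IsClosedUnderFiniteProducts where
  isClosedUnderLimitsOfShape J _ := ⟨by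
    rintro F ⟨p⟩
    have hev : ∀ Y : C, IsLimit (((evaluation C B).obj Y).mapCone (Cone.mk F p.π)) := fun Y =>
      isLimitOfPreserves ((evaluation C B).obj Y) p.isLimit
    refine ⟨⟨fun {X Y f g} => ?_⟩, ⟨fun {X Y} f r => ?_⟩⟩
    · refine (hev Y).hom_ext fun j => ?_
      obtain ⟨_, _⟩ := p.prop_diag_obj j
      simp
    · refine (hev Y).hom_ext fun j => ?_
      obtain ⟨_, _⟩ := p.prop_diag_obj j
      simp⟩

end Abelian

/-- The `k`-linearization `kQ` of the quiver `V`: objects are the vertices, and morphisms are the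
`k`-linear combinations of paths. -/
abbrev QuiverLinearization (k : Type w) [CommRing k] (V : Type u₁) [Quiver.{v₁} V] :=
  Free k (Paths V)

/-- The category `B^{kQ}` of representations of the quiver `V` over `B`. -/
abbrev QuiverRep (k : Type w) [CommRing k] (V : Type u₁) [Quiver.{v₁} V]
    (B : Type u₂) [Category.{v₂} B] [Preadditive B] [Linear k B] :=
  LinearFunctorCategory k (QuiverLinearization k V) B

namespace QuiverRep

variable {k : Type w} [CommRing k] {V : Type u₁} [Quiver.{v₁} V]
  {B : Type u₂} [Category.{v₂} B] [Abelian B] [Linear k B]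

/-- The object `F(i)` of a representation at a vertex `i`. -/
def vertex (F : QuiverRep k V B) (i : V) : B :=
  F.obj.obj ((Free.embedding k (Paths V)).obj ((Paths.of V).obj i))

/-- The morphism `f_α : F(s(α)) ⟶ F(t(α))` of a representation at an arrow `α`. -/
def arrow (F : QuiverRep k V B) {i j : V} (α : i ⟶ j) : vertex F i ⟶ vertex F j :=
  F.obj.map ((Free.embedding k (Paths V)).map ((Paths.of V).map α))

variable [LocallyBoundedQuiver V]

attribute [local instance] Abelian.hasFiniteBiproducts

/-- The morphism `(f_α)_{t(α) = i} : ⨁_{t(α) = i} F(s(α)) ⟶ F(i)`. -/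
def incoming (F : QuiverRep k V B) (i : V) :
    (⨁ fun α : Quiver.Costar i => vertex F α.1) ⟶ vertex F i :=
  biproduct.desc fun α => arrow F α.2

/-- A representation is monic if `(f_α)_{t(α) = i}` is a monomorphism for every vertex `i`. -/
def IsMonic (F : QuiverRep k V B) : Prop :=
  ∀ i : V, Mono (incoming F i)

end QuiverRep

end Representations

end

/-! Call a short exact sequence X ⟶ P ⟶ Y with P projective a step if Hom(-, Q) keeps it exact for
every projective Q (`IsGorensteinStep`). Splicing steps gives a totally acyclic complex, so an
object is Gorenstein projective once it lies in a class whose members have steps on both sides that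
stay in the class (`isGorensteinProjective_of_class`). Every claim thus reduces to single short
exact sequences.

Write `top F i` for the cokernel at `i`. If F is monic with Gorenstein projective tops, then Ext¹(F,
N) = 0 for every N that is projective at each vertex (`extVanishes_of_isMonic`): a section is built
vertex by vertex along the arrows, a well-founded process since an arrow strictly increases the
number of incoming paths. Steps for the tops in `B` then lift to steps for F with middle term the
free representation `induced P`, whose top at `i` is `P i`. On the left this uses projectivity of `P
i`; on the right, F ⟶ `discrete P` is lifted to `induced P` by Ext vanishing.

Conversely, a Gorenstein projective F embeds into a projective representation, hence is monic. A
vertexwise projective T has a projective resolution of length one, so steps starting at F stay exact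
under Hom(-, T) as well (`exists_extension_of_pointwise`). Taking for T the values of the right
adjoints `simple` of `top` and `coinduced` of evaluation shows that both functors send steps to
steps, and the class criterion applies in `B`. -/

noncomputable section

/-! ### Vanishing of Ext¹ in terms of split extensions. -/

section AbelianCategory

variable {A : Type u} [Category.{v} A] [Abelian A]

lemma kernel_shortExact {F G : A} (φ : F ⟶ G) [Epi φ] :
    (ShortComplex.mk (kernel.ι φ) φ (kernel.condition φ)).ShortExact :=
  .mk' (ShortComplex.exact_kernel φ) inferInstance inferInstance

lemma cokernel_shortExact {F G : A} (φ : F ⟶ G) [Mono φ] :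
    (ShortComplex.mk φ (cokernel.π φ) (cokernel.condition φ)).ShortExact :=
  .mk' (ShortComplex.exact_cokernel φ) inferInstance inferInstance

/-- `Ext¹(C, N)` vanishes: every extension of `C` by `N` splits. -/
def ExtVanishes (C N : A) : Prop :=
  ∀ (E : A) (i : N ⟶ E) (p : E ⟶ C) (w : i ≫ p = 0), (ShortComplex.mk i p w).ShortExact →
    ∃ r : E ⟶ N, i ≫ r = 𝟙 N

namespace ExtVanishes

lemma of_iso {C C' N : A} (h : ExtVanishes C N) (e : C ≅ C') : ExtVanishes C' N := by
  intro E i p w hS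
  have w' : i ≫ p ≫ e.inv = 0 := by rw [reassoc_of% w, zero_comp]
  refine h E i (p ≫ e.inv) w' ?_
  let f : ShortComplex.mk i p w ≅ ShortComplex.mk i (p ≫ e.inv) w' :=
    ShortComplex.isoMk (Iso.refl _) (Iso.refl _) e.symm (by simp) (by simp)
  exact ShortComplex.shortExact_of_iso f hS

/-- Morphisms to `N` extend along a monomorphism whose cokernel is `S.X₃`. -/
lemma exists_extension {S : ShortComplex A} {N : A} (h : ExtVanishes S.X₃ N) (hS : S.ShortExact)
    (f : S.X₁ ⟶ N) : ∃ g : S.X₂ ⟶ N, S.f ≫ g = f := by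
  have := hS.mono_f
  have := hS.epi_g
  -- The pushout of `S` along `f` is an extension of `S.X₃` by `N`; a retraction of it extends `f`.
  let p : pushout S.f f ⟶ S.X₃ := pushout.desc S.g 0 (by simp)
  have w : pushout.inr S.f f ≫ p = 0 := pushout.inr_desc _ _ _
  have hp : pushout.inl S.f f ≫ p = S.g := pushout.inl_desc _ _ _
  have : Epi p := epi_of_epi_fac hp
  have hex : (ShortComplex.mk (pushout.inr S.f f) p w).Exact := by
    refine ShortComplex.exact_of_g_is_cokernel _ (CokernelCofork.IsColimit.ofπ' _ _ fun k hk => ?_)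
    have hk' : S.f ≫ pushout.inl S.f f ≫ k = 0 := by
      rw [pushout.condition_assoc, hk, comp_zero]
    refine ⟨hS.exact.desc _ hk', ?_⟩
    apply pushout.hom_ext
    · rw [reassoc_of% hp, hS.exact.g_desc]
    · rw [reassoc_of% w, zero_comp, hk]
  obtain ⟨r, hr⟩ := h _ _ _ _ (ShortComplex.ShortExact.mk' hex inferInstance inferInstance)
  exact ⟨pushout.inl _ _ ≫ r, by rw [pushout.condition_assoc, hr, Category.comp_id]⟩

/-- Morphisms from `C` lift along an epimorphism whose kernel is `S.X₁`. -/
lemma exists_lift {S : ShortComplex A} {C : A} (h : ExtVanishes C S.X₁) (hS : S.ShortExact)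
    (f : C ⟶ S.X₃) : ∃ g : C ⟶ S.X₂, g ≫ S.g = f := by
  have := hS.mono_f
  have := hS.epi_g
  let i : S.X₁ ⟶ pullback S.g f := pullback.lift S.f 0 (by simp)
  have w : i ≫ pullback.snd S.g f = 0 := pullback.lift_snd _ _ _
  have hi : i ≫ pullback.fst S.g f = S.f := pullback.lift_fst _ _ _
  have : Mono i := mono_of_mono_fac hi
  have hex : (ShortComplex.mk i (pullback.snd S.g f) w).ShortExact := by
    refine ShortComplex.ShortExact.mk' ?_ inferInstance inferInstance
    refine ShortComplex.exact_of_f_is_kernel _ (KernelFork.IsLimit.ofι' _ _ fun k hk => ?_)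
    have hk' : (k ≫ pullback.fst S.g f) ≫ S.g = 0 := by
      rw [Category.assoc, pullback.condition, reassoc_of% hk, zero_comp]
    refine ⟨hS.exact.lift _ hk', ?_⟩
    apply pullback.hom_ext
    · rw [Category.assoc, hi, hS.exact.lift_f]
    · rw [Category.assoc, w, comp_zero, hk]
  obtain ⟨r, hr⟩ := h _ _ _ _ hex
  -- The idempotent complementary to `r ≫ i` kills the kernel, so it descends to a section of
  -- `pullback.snd`.
  have hz : i ≫ (𝟙 _ - r ≫ i) = 0 := by
    rw [Preadditive.comp_sub, reassoc_of% hr, Category.comp_id, sub_self]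
  refine ⟨hex.exact.desc _ hz ≫ pullback.fst _ _, ?_⟩
  rw [Category.assoc, pullback.condition, ← Category.assoc]
  conv_rhs => rw [← Category.id_comp f]
  congr 1
  rw [← cancel_epi (pullback.snd S.g f)]
  have := hex.exact.g_desc _ hz
  dsimp at this
  rw [reassoc_of% this, Preadditive.sub_comp, Category.assoc, w, comp_zero, sub_zero,
    Category.id_comp, Category.comp_id]

/-- A monomorphism with cokernel `C` has the left lifting property, in squares with an identity at
the bottom, against an epimorphism with kernel `N`, if `Ext¹(C, N)` vanishes. -/
lemma exists_section {N E : A} {i : N ⟶ E} {S : ShortComplex A} (hS : S.ShortExact)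
    {p : E ⟶ S.X₂} {w : i ≫ p = 0} (hE : (ShortComplex.mk i p w).ShortExact)
    (h : ExtVanishes S.X₃ N) (s₀ : S.X₁ ⟶ E) (hs₀ : s₀ ≫ p = S.f) :
    ∃ s : S.X₂ ⟶ E, s ≫ p = 𝟙 _ ∧ S.f ≫ s = s₀ := by
  have := hS.mono_f
  have := hS.epi_g
  have := hE.mono_f
  have hepi : Epi p := hE.epi_g
  have : Mono s₀ := mono_of_mono_fac hs₀
  -- Dividing `E` by the partial section leaves an extension of `S.X₃` by `N`. The copy of `N`
  -- survives because `s₀ ≫ p = S.f` is mono, so `N` meets the image of `s₀` in zero.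
  let q : cokernel s₀ ⟶ S.X₃ := cokernel.desc s₀ (p ≫ S.g) (by rw [reassoc_of% hs₀, S.zero])
  have hq : cokernel.π s₀ ≫ q = p ≫ S.g := by simp [q]
  have : Epi q := by
    have : Epi (p ≫ S.g) := epi_comp _ _
    exact epi_of_epi_fac hq
  have w' : (i ≫ cokernel.π s₀) ≫ q = 0 := by rw [Category.assoc, hq, reassoc_of% w, zero_comp]
  have hs := cokernel_shortExact s₀
  have hmono : Mono (i ≫ cokernel.π s₀) := by
    rw [Preadditive.mono_iff_cancel_zero]
    intro T t ht
    rw [← Category.assoc] at ht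
    obtain ⟨l, hl⟩ := hs.exact.lift' _ ht
    dsimp at l hl
    have : l ≫ S.f = 0 := by rw [← hs₀, reassoc_of% hl, w, comp_zero]
    have hl0 : l = 0 := by rw [← cancel_mono S.f, this, zero_comp]
    rw [← cancel_mono i, ← hl, hl0, zero_comp, zero_comp]
  have hex : (ShortComplex.mk (i ≫ cokernel.π s₀) q w').ShortExact := by
    refine ShortComplex.ShortExact.mk' ?_ hmono inferInstance
    refine ShortComplex.exact_of_g_is_cokernel _ (CokernelCofork.IsColimit.ofπ' _ _ fun k hk => ?_)
    rw [Category.assoc] at hk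
    have hd := hE.exact.g_desc _ hk
    dsimp at hd
    have hk' : S.f ≫ hE.exact.desc _ hk = 0 := by
      rw [← hs₀, Category.assoc, hd, cokernel.condition_assoc, zero_comp]
    refine ⟨hS.exact.desc _ hk', ?_⟩
    rw [← cancel_epi (cokernel.π s₀), reassoc_of% hq, hS.exact.g_desc]
    exact hd
  obtain ⟨r, hr⟩ := h _ _ _ _ hex
  -- This endomorphism of `E` kills `N`, hence descends to the section sought; it is the identity on
  -- `s₀`, since the subtracted term factors through the cokernel of `s₀`.
  have hz : i ≫ (𝟙 E - cokernel.π s₀ ≫ r ≫ i) = 0 := by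
    simp only [Category.assoc] at hr
    rw [Preadditive.comp_sub, reassoc_of% hr, Category.comp_id, sub_self]
  have hd := hE.exact.g_desc _ hz
  dsimp at hd
  refine ⟨hE.exact.desc _ hz, ?_, ?_⟩
  · rw [← cancel_epi p, reassoc_of% hd, Preadditive.sub_comp]
    simp [w]
  · rw [← hs₀, Category.assoc, hd, Preadditive.comp_sub]
    simp

end ExtVanishes

/-! ### Consequences of the snake lemma for cokernels. -/

section Snake

variable {S₁ S₂ : ShortComplex A} (φ : S₁ ⟶ S₂)

/-- The snake input given by a morphism between short exact sequences. -/
def snakeInput (h₁ : S₁.ShortExact) (h₂ : S₂.ShortExact) : ShortComplex.SnakeInput A where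
  L₀ := kernel φ
  L₁ := S₁
  L₂ := S₂
  L₃ := cokernel φ
  v₀₁ := kernel.ι φ
  v₁₂ := φ
  v₂₃ := cokernel.π φ
  w₀₂ := kernel.condition φ
  w₁₃ := cokernel.condition φ
  h₀ := kernelIsKernel φ
  h₃ := cokernelIsCokernel φ
  L₁_exact := h₁.exact
  epi_L₁_g := h₁.epi_g
  L₂_exact := h₂.exact
  mono_L₂_f := h₂.mono_f

/-- The sequence of cokernels of a morphism of short complexes. -/
def cokernelShortComplex : ShortComplex A :=
  ShortComplex.mk (cokernel.map φ.τ₁ φ.τ₂ S₁.f S₂.f φ.comm₁₂)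
    (cokernel.map φ.τ₂ φ.τ₃ S₁.g S₂.g φ.comm₂₃) (by ext; simp)

def snakeInputIso (h₁ : S₁.ShortExact) (h₂ : S₂.ShortExact) :
    (snakeInput φ h₁ h₂).L₃ ≅ cokernelShortComplex φ :=
  ShortComplex.isoMk
    ((snakeInput φ h₁ h₂).h₃τ₁.coconePointUniqueUpToIso (colimit.isColimit (parallelPair φ.τ₁ 0)))
    ((snakeInput φ h₁ h₂).h₃τ₂.coconePointUniqueUpToIso (colimit.isColimit (parallelPair φ.τ₂ 0)))
    ((snakeInput φ h₁ h₂).h₃τ₃.coconePointUniqueUpToIso (colimit.isColimit (parallelPair φ.τ₃ 0)))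
    (by
      refine Cofork.IsColimit.hom_ext (snakeInput φ h₁ h₂).h₃τ₁ ?_
      have e₁ := (snakeInput φ h₁ h₂).h₃τ₁.comp_coconePointUniqueUpToIso_hom
        (colimit.isColimit (parallelPair φ.τ₁ 0)) WalkingParallelPair.one
      have e₂ := (snakeInput φ h₁ h₂).h₃τ₂.comp_coconePointUniqueUpToIso_hom
        (colimit.isColimit (parallelPair φ.τ₂ 0)) WalkingParallelPair.one
      have c := (snakeInput φ h₁ h₂).v₂₃.comm₁₂
      dsimp [cokernelShortComplex] at e₁ e₂ c ⊢
      erw [reassoc_of% e₁, reassoc_of% c, e₂]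
      exact cokernel.π_desc _ _ _)
    (by
      refine Cofork.IsColimit.hom_ext (snakeInput φ h₁ h₂).h₃τ₂ ?_
      have e₁ := (snakeInput φ h₁ h₂).h₃τ₂.comp_coconePointUniqueUpToIso_hom
        (colimit.isColimit (parallelPair φ.τ₂ 0)) WalkingParallelPair.one
      have e₂ := (snakeInput φ h₁ h₂).h₃τ₃.comp_coconePointUniqueUpToIso_hom
        (colimit.isColimit (parallelPair φ.τ₃ 0)) WalkingParallelPair.one
      have c := (snakeInput φ h₁ h₂).v₂₃.comm₂₃
      dsimp [cokernelShortComplex] at e₁ e₂ c ⊢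
      erw [reassoc_of% e₁, reassoc_of% c, e₂]
      exact cokernel.π_desc _ _ _)

lemma cokernelShortComplex_shortExact (h₁ : S₁.ShortExact) (h₂ : S₂.ShortExact) [Mono φ.τ₃] :
    (cokernelShortComplex φ).ShortExact := by
  let I := snakeInput φ h₁ h₂
  have h0 : IsZero I.L₀.X₃ := by
    have : Mono I.v₁₂.τ₃ := ‹Mono φ.τ₃›
    rw [IsZero.iff_id_eq_zero, ← cancel_mono I.v₀₁.τ₃, ← cancel_mono I.v₁₂.τ₃]
    simp
  have : Epi I.L₂.g := h₂.epi_g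
  have hm : Mono I.L₃.f := I.L₂'_exact.mono_g (h0.eq_of_src _ _)
  have he : Epi I.L₃.g := inferInstance
  exact ShortComplex.shortExact_of_iso (snakeInputIso φ h₁ h₂)
    (ShortComplex.ShortExact.mk' I.L₃_exact hm he)

/-- The connecting morphism is mono because the kernel of `φ.τ₂` vanishes, and zero because the next
map in the snake sequence is mono. Hence its source, the kernel of `φ.τ₃`, is zero. -/
lemma mono_τ₃_of_mono_cokernel_map (h₁ : S₁.ShortExact) (h₂ : S₂.ShortExact) [Mono φ.τ₂]
    [hc : Mono (cokernelShortComplex φ).f] : Mono φ.τ₃ := by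
  let I := snakeInput φ h₁ h₂
  have h0 : IsZero I.L₀.X₂ := by
    have : Mono I.v₁₂.τ₂ := ‹Mono φ.τ₂›
    rw [IsZero.iff_id_eq_zero, ← cancel_mono I.v₀₁.τ₂, ← cancel_mono I.v₁₂.τ₂]
    simp
  have hδ := I.mono_δ h0
  have hf : Mono I.L₃.f := by
    have e := (snakeInputIso φ h₁ h₂).hom.comm₁₂
    have hm : Mono ((snakeInputIso φ h₁ h₂).hom.τ₁ ≫ (cokernelShortComplex φ).f) :=
      mono_comp _ _
    rw [e] at hm
    exact mono_of_mono I.L₃.f (snakeInputIso φ h₁ h₂).hom.τ₂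
  have hδ0 : I.δ = 0 := by rw [← cancel_mono I.L₃.f, I.δ_L₃_f, zero_comp]
  have h3 : IsZero I.L₀.X₃ := by
    rw [IsZero.iff_id_eq_zero, ← cancel_mono I.δ, hδ0, comp_zero, comp_zero]
  exact I.exact_C₃_up.mono_g (h3.eq_of_src _ _)

end Snake

/-! ### Gorenstein projectivity through spliced short exact sequences. -/

section GorensteinProjective

/-- A short exact sequence `0 ⟶ X ⟶ P ⟶ Y ⟶ 0` with `P` projective that stays exact under
`Hom(-, Q)` for every projective object `Q`. -/
structure IsGorensteinStep {X P Y : A} (ι : X ⟶ P) (π : P ⟶ Y) : Prop where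
  projective : Projective P
  w : ι ≫ π = 0
  shortExact : (ShortComplex.mk ι π w).ShortExact
  extend : ∀ (Q : A) (_ : Projective Q) (f : X ⟶ Q), ∃ g : P ⟶ Q, ι ≫ g = f

/-- Splicing a family of short exact sequences gives a complete resolution. -/
lemma isGorensteinProjective_of_family (Z : ℤ → A)
    (hZ : ∀ n : ℤ, ∃ (P : A) (ι : Z n ⟶ P), ∀ m, m + 1 = n → ∃ π : P ⟶ Z m,
      IsGorensteinStep ι π) : IsGorensteinProjective (Z 0) := by
  -- `P` and `ι` depend on `n` alone, while `π` takes both indices and a proof of `m + 1 = n`; this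
  -- avoids transport along `n - 1 + 1 = n`.
  choose P ι π h using hZ
  let K : ChainComplex A ℤ :=
    { X := P
      d := fun i j => if e : j + 1 = i then π i j e ≫ ι j else 0
      shape := fun i j e => dif_neg e
      d_comp_d' := by
        rintro i j k rfl rfl
        simp [reassoc_of% (h (k + 1) k rfl).w] }
  have hd (i j : ℤ) (e : j + 1 = i) : K.d i j = π i j e ≫ ι j := dif_pos e
  have hmono (i : ℤ) : Mono (ι i) := (h i (i - 1) (by simp)).shortExact.mono_f
  have hepi (i j : ℤ) (e : j + 1 = i) : Epi (π i j e) := (h i j e).shortExact.epi_g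
  refine ⟨K, ⟨fun n => (h n (n - 1) (by simp)).projective, fun n => ?_, fun Q hQ n f hf => ?_⟩,
    ι 0, ?_, ⟨?_⟩⟩
  · rw [K.exactAt_iff' (n + 1) n (n - 1) (by simp) (by simp)]
    have hS := (h n (n - 1) (by simp)).shortExact
    have e₁ := hd (n + 1) n rfl
    have e₂ := hd n (n - 1) (by simp)
    have := hepi (n + 1) n rfl
    have := hmono (n - 1)
    rw [ShortComplex.exact_iff_exact_up_to_refinements]
    intro T (x : T ⟶ P n) (hx : x ≫ K.d n (n - 1) = 0)
    replace hx : x ≫ π n (n - 1) (by simp) ≫ ι (n - 1) = 0 := (x ≫= e₂).symm.trans hx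
    rw [← Category.assoc, ← zero_comp (f := ι (n - 1)), cancel_mono] at hx
    obtain ⟨y, hy⟩ := hS.exact.lift' x hx
    dsimp at y hy
    -- The cycle `y` in `Z n` lifts through the epimorphism `π` only after passing to a cover.
    refine ⟨pullback y (π (n + 1) n rfl), pullback.fst _ _, inferInstance, pullback.snd _ _, ?_⟩
    refine Eq.trans ?_ (pullback.snd _ _ ≫= e₁).symm
    rw [← pullback.condition_assoc, hy]
    rfl
  · have e₁ := hd (n + 1) n rfl
    have e₂ := hd n (n - 1) (by simp)
    have hS := h n (n - 1) (by simp)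
    have := hS.shortExact.epi_g
    rw [e₁, Category.assoc, ← comp_zero (f := π (n + 1) n rfl), cancel_epi] at hf
    obtain ⟨f', hf'⟩ := hS.shortExact.exact.desc' f hf
    obtain ⟨g, hg⟩ := (h (n - 1) (n - 1 - 1) (by simp)).extend Q hQ f'
    exact ⟨g, by rw [e₂, Category.assoc, hg]; exact hf'⟩
  · have hS := h 0 (-1) (by simp)
    rw [hd 0 (-1) (by simp), reassoc_of% hS.w, zero_comp]
  · have hS := h 0 (-1) (by simp)
    have := hS.shortExact.mono_f
    have := hmono (-1)
    refine KernelFork.IsLimit.ofι' _ _ fun k hk => ?_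
    rw [hd 0 (-1) (by simp), ← Category.assoc, ← zero_comp (f := ι (-1)), cancel_mono] at hk
    exact ⟨hS.shortExact.exact.lift k hk, hS.shortExact.exact.lift_f k hk⟩

/-- Membership in a class of objects that can be resolved in both directions inside the class
implies being Gorenstein projective. -/
lemma isGorensteinProjective_of_class (G : A → Prop)
    (left : ∀ X, G X → ∃ (Y P : A) (ι : Y ⟶ P) (π : P ⟶ X), G Y ∧ IsGorensteinStep ι π)
    (right : ∀ X, G X → ∃ (P Y : A) (ι : X ⟶ P) (π : P ⟶ Y), G Y ∧ IsGorensteinStep ι π)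
    {X : A} (hX : G X) : IsGorensteinProjective X := by
  choose l lP lι lπ hl lstep using left
  choose rP r rι rπ hr rstep using right
  -- Iterated left and right neighbours of `X`. They are glued at `X`, which sits in degree 0; the
  -- right ones are shifted by one because `Int.negSucc m` is `-(m + 1)`.
  let L : ℕ → Subtype G := fun n => Nat.rec ⟨X, hX⟩ (fun _ Y => ⟨l Y.1 Y.2, hl Y.1 Y.2⟩) n
  let R : ℕ → Subtype G := fun n => Nat.rec ⟨X, hX⟩ (fun _ Y => ⟨r Y.1 Y.2, hr Y.1 Y.2⟩) n
  let Z : ℤ → A := fun n => Int.rec (fun m => (L m).1) (fun m => (R (m + 1)).1) n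
  change IsGorensteinProjective (Z 0)
  refine isGorensteinProjective_of_family Z fun n => ?_
  rcases n with (_ | n) | n
  · refine ⟨rP X hX, rι X hX, fun m hm => ?_⟩
    obtain rfl : m = Int.negSucc 0 := by
      have : Int.ofNat 0 = 0 := rfl
      omega
    exact ⟨rπ X hX, rstep X hX⟩
  · refine ⟨lP (L n).1 (L n).2, lι (L n).1 (L n).2, fun m hm => ?_⟩
    obtain rfl : m = Int.ofNat n := by
      have : Int.ofNat (n + 1) = (n : ℤ) + 1 := rfl
      have : Int.ofNat n = (n : ℤ) := rfl
      omega
    exact ⟨lπ _ _, lstep _ _⟩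
  · refine ⟨rP (R (n + 1)).1 (R (n + 1)).2, rι _ _, fun m hm => ?_⟩
    obtain rfl : m = Int.negSucc (n + 1) := by omega
    exact ⟨rπ _ _, rstep _ _⟩

/-- The objects that are cycles of totally acyclic complexes, in an arbitrary degree. -/
def IsCycleOfTotallyAcyclic (X : A) : Prop :=
  ∃ (K : ChainComplex A ℤ) (_ : IsTotallyAcyclic K) (i j : ℤ) (_ : j + 1 = i) (ι : X ⟶ K.X i)
    (w : ι ≫ K.d i j = 0), Nonempty (IsLimit (KernelFork.ofι ι w))

/-- By acyclicity the differentials factor as epimorphisms onto cycles followed by inclusions. A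
morphism `X ⟶ Q` pulled back to degree `i + 1` vanishes on boundaries, so total acyclicity extends
it to `K.X i`. -/
lemma IsTotallyAcyclic.exists_step {K : ChainComplex A ℤ} (hK : IsTotallyAcyclic K) {X Y : A}
    {i j l : ℤ} (hij : j + 1 = i) (hjl : l + 1 = j) {ι : X ⟶ K.X i} {w : ι ≫ K.d i j = 0}
    (hX : IsLimit (KernelFork.ofι ι w)) {ι' : Y ⟶ K.X j} {w' : ι' ≫ K.d j l = 0}
    (hY : IsLimit (KernelFork.ofι ι' w')) : ∃ π : K.X i ⟶ Y, IsGorensteinStep ι π := by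
  have hmono : Mono ι := mono_of_isLimit_fork hX
  have hmono' : Mono ι' := mono_of_isLimit_fork hY
  have key {i j l : ℤ} (hij : j + 1 = i) (hjl : l + 1 = j) {Y : A} {ι' : Y ⟶ K.X j}
      {w' : ι' ≫ K.d j l = 0} (hY : IsLimit (KernelFork.ofι ι' w')) :
      ∃ π : K.X i ⟶ Y, π ≫ ι' = K.d i j ∧ Epi π := by
    obtain ⟨π, hπ⟩ := KernelFork.IsLimit.lift' hY (K.d i j) (K.d_comp_d _ _ _)
    have hmono' : Mono ι' := mono_of_isLimit_fork hY
    have hex : (ShortComplex.mk (K.d i j) (K.d j l) (K.d_comp_d _ _ _)).Exact :=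
      (K.exactAt_iff' i j l (by simp [hij]) (by simp [← hjl])).1 (hK.acyclic j)
    obtain ⟨π, hπ⟩ : ∃ π : K.X i ⟶ Y, π ≫ ι' = K.d i j := ⟨π, hπ⟩
    refine ⟨π, hπ, ?_⟩
    rw [epi_iff_surjective_up_to_refinements]
    intro T y
    have hy : (y ≫ ι') ≫ K.d j l = 0 := by rw [Category.assoc, w', comp_zero]
    obtain ⟨T', t, ht, x, hx⟩ := hex.exact_up_to_refinements (y ≫ ι') hy
    refine ⟨T', t, ht, x, ?_⟩
    dsimp at x hx
    rw [← cancel_mono ι', Category.assoc, hx, Category.assoc, hπ]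
  obtain ⟨π, hπ, hepi⟩ := key hij hjl hY
  obtain ⟨ρ, hρ, hepi'⟩ := key (i := i + 1) rfl hij hX
  have hw : ι ≫ π = 0 := by rw [← cancel_mono ι', Category.assoc, hπ, w, zero_comp]
  refine ⟨π, hK.projective i, hw, ?_, fun Q hQ f => ?_⟩
  · refine ShortComplex.ShortExact.mk' ?_ hmono hepi
    refine ShortComplex.exact_of_f_is_kernel _ (KernelFork.IsLimit.ofι' _ _ fun k hk => ?_)
    obtain ⟨s, hs⟩ := KernelFork.IsLimit.lift' hX k (by
      dsimp at hk; rw [← hπ, reassoc_of% hk, zero_comp])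
    exact ⟨s, hs⟩
  · obtain rfl : j = i - 1 := by omega
    have hz : K.d (i + 1 + 1) (i + 1) ≫ ρ ≫ f = 0 := by
      have : K.d (i + 1 + 1) (i + 1) ≫ ρ = 0 := by
        rw [← cancel_mono ι, Category.assoc, hρ, K.d_comp_d, zero_comp]
      rw [reassoc_of% this, zero_comp]
    obtain ⟨g, hg⟩ := hK.hom_acyclic Q hQ (i + 1) (ρ ≫ f) hz
    generalize hm : i + 1 - 1 = m at g hg
    obtain rfl : m = i := by omega
    exact ⟨g, by rw [← cancel_epi ρ, ← hg, ← hρ, Category.assoc]⟩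

lemma IsCycleOfTotallyAcyclic.exists_left {X : A} (hX : IsCycleOfTotallyAcyclic X) :
    ∃ (Y P : A) (ι : Y ⟶ P) (π : P ⟶ X), IsCycleOfTotallyAcyclic Y ∧ IsGorensteinStep ι π := by
  obtain ⟨K, hK, i, j, hij, ι, w, ⟨h⟩⟩ := hX
  obtain ⟨π, hπ⟩ := hK.exists_step (i := i + 1) (w := kernel.condition _) rfl hij (kernelIsKernel (K.d (i + 1) i)) h
  exact ⟨_, _, _, π, ⟨K, hK, i + 1, i, rfl, _, kernel.condition _, ⟨kernelIsKernel _⟩⟩, hπ⟩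

lemma IsCycleOfTotallyAcyclic.exists_right {X : A} (hX : IsCycleOfTotallyAcyclic X) :
    ∃ (P Y : A) (ι : X ⟶ P) (π : P ⟶ Y), IsCycleOfTotallyAcyclic Y ∧ IsGorensteinStep ι π := by
  obtain ⟨K, hK, i, j, hij, ι, w, ⟨h⟩⟩ := hX
  obtain ⟨π, hπ⟩ := hK.exists_step (w' := kernel.condition _) hij (sub_add_cancel j 1) h (kernelIsKernel (K.d j (j - 1)))
  exact ⟨_, _, _, π, ⟨K, hK, j, j - 1, by simp, _, kernel.condition _, ⟨kernelIsKernel _⟩⟩, hπ⟩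

/-- Cutting the complex into steps and splicing them again around `X` replaces a shift of degrees.
-/
lemma IsCycleOfTotallyAcyclic.isGorensteinProjective {X : A} (hX : IsCycleOfTotallyAcyclic X) :
    IsGorensteinProjective X :=
  isGorensteinProjective_of_class IsCycleOfTotallyAcyclic (fun _ h => h.exists_left)
    (fun _ h => h.exists_right) hX

namespace IsGorensteinProjective

variable {X : A}

lemma isCycleOfTotallyAcyclic (hX : IsGorensteinProjective X) : IsCycleOfTotallyAcyclic X := by
  obtain ⟨K, hK, ι, w, h⟩ := hX
  exact ⟨K, hK, 0, -1, by simp, ι, w, h⟩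

lemma exists_left (hX : IsGorensteinProjective X) :
    ∃ (Y P : A) (ι : Y ⟶ P) (π : P ⟶ X), IsGorensteinProjective Y ∧ IsGorensteinStep ι π := by
  obtain ⟨Y, P, ι, π, hY, h⟩ := hX.isCycleOfTotallyAcyclic.exists_left
  exact ⟨Y, P, ι, π, hY.isGorensteinProjective, h⟩

lemma exists_right (hX : IsGorensteinProjective X) :
    ∃ (P Y : A) (ι : X ⟶ P) (π : P ⟶ Y), IsGorensteinProjective Y ∧ IsGorensteinStep ι π := by
  obtain ⟨P, Y, ι, π, hY, h⟩ := hX.isCycleOfTotallyAcyclic.exists_right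
  exact ⟨P, Y, ι, π, hY.isGorensteinProjective, h⟩

lemma of_iso {Y : A} (hX : IsGorensteinProjective X) (e : X ≅ Y) : IsGorensteinProjective Y := by
  obtain ⟨K, hK, ι, w, ⟨h⟩⟩ := hX
  refine ⟨K, hK, e.inv ≫ ι, by simp [w], ⟨?_⟩⟩
  refine IsLimit.ofIsoLimit h (Fork.ext e ?_)
  simp

/-- `Ext¹(X, Q) = 0` for `X` Gorenstein projective and `Q` projective. -/
lemma extVanishes (hX : IsGorensteinProjective X) (Q : A) [Projective Q] : ExtVanishes X Q := by
  intro E i p w hS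
  obtain ⟨Y, P, ι, π, -, h⟩ := hX.exists_left
  have := h.projective
  have hepi : Epi p := hS.epi_g
  have hmono : Mono i := hS.mono_f
  have hepi' : Epi π := h.shortExact.epi_g
  have hl : Projective.factorThru π p ≫ p = π := Projective.factorThru_comp _ _
  generalize Projective.factorThru π p = l at hl
  obtain ⟨f, hf⟩ := hS.exact.lift' (ι ≫ l) (by dsimp; rw [Category.assoc, hl, h.w])
  obtain ⟨g, hg⟩ := h.extend Q inferInstance f
  dsimp at f hf
  -- The lift `l` of `π` is corrected by `g ≫ i` so as to vanish on `Y`; what descends to `X` is a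
  -- section of `p`.
  obtain ⟨s, hs⟩ := h.shortExact.exact.desc' (l - g ≫ i) (by
    dsimp
    rw [Preadditive.comp_sub, reassoc_of% hg, hf, sub_self])
  dsimp at s hs
  have hsp : s ≫ p = 𝟙 X := by
    rw [← cancel_epi π, reassoc_of% hs, Preadditive.sub_comp, Category.assoc, w, hl]
    simp
  obtain ⟨r, hr⟩ := hS.exact.lift' (𝟙 E - p ≫ s) (by
    dsimp
    rw [Preadditive.sub_comp, Category.assoc, hsp]
    simp)
  dsimp at r hr
  refine ⟨r, ?_⟩
  rw [← cancel_mono i, Category.assoc, hr, Preadditive.comp_sub, reassoc_of% w]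
  simp

end IsGorensteinProjective

end GorensteinProjective

end AbelianCategory
end

noncomputable section

/-! ### Universal property of the linearization. -/

section FreeLift

variable (R : Type w) [CommRing R] {C : Type u₁} [Category.{v₁} C] {D : Type u₂} [Category.{v₂} D]
  [Preadditive D] [Linear R D]

def freeLiftHom (F : C ⥤ D) (X Y : C) : ((X ⟶ Y) →₀ R) →ₗ[R] (F.obj X ⟶ F.obj Y) :=
  Finsupp.linearCombination R (fun f : X ⟶ Y => F.map f)

lemma freeLiftHom_comp (F : C ⥤ D) {X Y Z : C} (f : (X ⟶ Y) →₀ R) (g : (Y ⟶ Z) →₀ R) :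
    freeLiftHom R F X Z (f.sum fun f' s => g.sum fun g' t => Finsupp.single (f' ≫ g') (s * t)) =
      freeLiftHom R F X Y f ≫ freeLiftHom R F Y Z g := by
  simp only [Finsupp.sum, map_sum]
  simp only [freeLiftHom, Finsupp.linearCombination_single]
  simp only [Finsupp.linearCombination_apply, Finsupp.sum, Preadditive.sum_comp,
    Preadditive.comp_sum, Functor.map_comp, Linear.smul_comp, Linear.comp_smul, mul_smul]
  simp only [Finset.smul_sum]
  rw [Finset.sum_comm]
  exact Finset.sum_congr rfl fun _ _ => Finset.sum_congr rfl fun _ _ => smul_comm _ _ _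

/-- The extension of a functor to a `R`-linear category to the `R`-linearization. -/
def freeLift (F : C ⥤ D) : Free R C ⥤ D where
  obj X := F.obj X
  map {X Y} f := freeLiftHom R F X Y f
  map_id X := (Finsupp.linearCombination_single R 1 (𝟙 (show C from X))).trans ((one_smul _ _).trans (F.map_id (show C from X)))
  map_comp {X Y Z} f g := freeLiftHom_comp R F (X := X) (Y := Y) (Z := Z) f g

instance (F : C ⥤ D) : (freeLift R F).Additive := 
  ⟨fun {X Y} f g => (freeLiftHom R F X Y).map_add f g⟩

instance (F : C ⥤ D) : (freeLift R F).Linear R := 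
  ⟨fun {X Y} f r => (freeLiftHom R F X Y).map_smul r f⟩

lemma freeLift_map_embedding (F : C ⥤ D) {X Y : C} (f : X ⟶ Y) :
    (freeLift R F).map ((Free.embedding R C).map f) = F.map f := by
  have h := Finsupp.linearCombination_single R (v := fun f : X ⟶ Y => F.map f) (1 : R) f
  rw [one_smul] at h
  exact h

variable {R}

lemma free_hom_induction {X Y : C} {motive : ((Free.embedding R C).obj X ⟶ (Free.embedding R C).obj Y) → Prop} 
    (h0 : motive 0)
    (add : ∀ f g, motive f → motive g → motive (f + g))
    (smul : ∀ (r : R) (f : X ⟶ Y), motive (r • (Free.embedding R C).map f)) (f) : motive f :=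
  Finsupp.induction_linear (motive := motive) f h0 add fun f r =>
    have e : r • (Free.embedding R C).map f = (Finsupp.single f r : (X ⟶ Y) →₀ R) :=
      (Finsupp.smul_single r f 1).trans (congrArg (Finsupp.single f) (mul_one r))
    e ▸ smul r f

lemma free_naturality {F G : Free R C ⥤ D} [F.Additive] [G.Additive] [F.Linear R] [G.Linear R]
    {X Y : C} (a : F.obj ((Free.embedding R C).obj X) ⟶ G.obj ((Free.embedding R C).obj X))
    (b : F.obj ((Free.embedding R C).obj Y) ⟶ G.obj ((Free.embedding R C).obj Y))
    (h : ∀ f : X ⟶ Y, F.map ((Free.embedding R C).map f) ≫ b =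
      a ≫ G.map ((Free.embedding R C).map f))
    (f : (Free.embedding R C).obj X ⟶ (Free.embedding R C).obj Y) :
    F.map f ≫ b = a ≫ G.map f := by
  refine free_hom_induction (motive := fun f => F.map f ≫ b = a ≫ G.map f) ?_ ?_ ?_ f
  · rw [Functor.map_zero, Functor.map_zero, zero_comp, comp_zero]
  · intro f g hf hg
    rw [Functor.map_add, Functor.map_add, Preadditive.add_comp, Preadditive.comp_add, hf, hg]
  · intro r p
    rw [Functor.map_smul, Functor.map_smul, Linear.smul_comp, Linear.comp_smul, h]

end FreeLift

/-! ### Representations as data on vertices and arrows; exactness at vertices. -/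

namespace QuiverRep

variable {k : Type w} [CommRing k] {V : Type u₁} [Quiver.{v₁} V]
  {B : Type u₂} [Category.{v₂} B] [Abelian B] [Linear k B]

/-- The representation given by objects at the vertices and morphisms for the arrows. -/
def ofQuiver (X : V → B) (f : ∀ i j : V, (i ⟶ j) → (X i ⟶ X j)) : QuiverRep k V B :=
  ⟨freeLift k (Paths.lift { obj := X, map := fun {i j} α => f i j α }),
    ⟨inferInstance, inferInstance⟩⟩

lemma arrow_ofQuiver (X : V → B) (f : ∀ i j : V, (i ⟶ j) → (X i ⟶ X j)) {i j : V} (α : i ⟶ j) :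
    arrow (ofQuiver (k := k) X f) α = f i j α :=
  (freeLift_map_embedding k _ _).trans (Paths.lift_toPath _ α)

/-- The action of a path on a representation. -/
def pathMap (F : QuiverRep k V B) {i j : V} (p : Quiver.Path i j) : vertex F i ⟶ vertex F j :=
  F.obj.map ((Free.embedding k (Paths V)).map
    (show (Paths.of V).obj i ⟶ (Paths.of V).obj j from p))

lemma pathMap_nil (F : QuiverRep k V B) (i : V) :
    pathMap F (Quiver.Path.nil : Quiver.Path i i) = 𝟙 (vertex F i) :=
  (congrArg F.obj.map ((Free.embedding k (Paths V)).map_id ((Paths.of V).obj i))).trans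
    (F.obj.map_id _)

lemma pathMap_comp (F : QuiverRep k V B) {i j l : V} (p : Quiver.Path i j)
    (q : Quiver.Path j l) : pathMap F (p.comp q) = pathMap F p ≫ pathMap F q :=
  (congrArg F.obj.map ((Free.embedding k (Paths V)).map_comp
    (show (Paths.of V).obj i ⟶ (Paths.of V).obj j from p)
    (show (Paths.of V).obj j ⟶ (Paths.of V).obj l from q))).trans (F.obj.map_comp _ _)

lemma pathMap_toPath (F : QuiverRep k V B) {i j : V} (α : i ⟶ j) :
    pathMap F α.toPath = arrow F α := rfl

lemma pathMap_cons (F : QuiverRep k V B) {i j l : V} (p : Quiver.Path i j) (α : j ⟶ l) :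
    pathMap F (p.cons α) = pathMap F p ≫ arrow F α :=
  pathMap_comp F p α.toPath

/-- The component at a vertex of a morphism of representations. -/
def app {F G : QuiverRep k V B} (φ : F ⟶ G) (i : V) : vertex F i ⟶ vertex G i :=
  φ.hom.app _

@[simp]
lemma app_id (F : QuiverRep k V B) (i : V) : app (𝟙 F) i = 𝟙 _ := rfl

@[simp]
lemma app_comp {F G H : QuiverRep k V B} (φ : F ⟶ G) (ψ : G ⟶ H) (i : V) :
    app (φ ≫ ψ) i = app φ i ≫ app ψ i := rfl

@[simp]
lemma app_zero (F G : QuiverRep k V B) (i : V) : app (0 : F ⟶ G) i = 0 := rfl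

@[simp]
lemma app_add {F G : QuiverRep k V B} (φ ψ : F ⟶ G) (i : V) :
    app (φ + ψ) i = app φ i + app ψ i := rfl

lemma arrow_app {F G : QuiverRep k V B} (φ : F ⟶ G) {i j : V} (α : i ⟶ j) :
    arrow F α ≫ app φ j = app φ i ≫ arrow G α :=
  φ.hom.naturality _

lemma pathMap_app {F G : QuiverRep k V B} (φ : F ⟶ G) {i j : V} (p : Quiver.Path i j) :
    pathMap F p ≫ app φ j = app φ i ≫ pathMap G p :=
  φ.hom.naturality _

lemma hom_ext {F G : QuiverRep k V B} {φ ψ : F ⟶ G} (h : ∀ i, app φ i = app ψ i) : φ = ψ :=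
  ObjectProperty.hom_ext _ (NatTrans.ext (funext h))

lemma pathMap_naturality {F G : QuiverRep k V B} (u : ∀ i, vertex F i ⟶ vertex G i)
    (h : ∀ {i j : V} (α : i ⟶ j), arrow F α ≫ u j = u i ≫ arrow G α) {i j : V}
    (p : Quiver.Path i j) : pathMap F p ≫ u j = u i ≫ pathMap G p := by
  induction p with
  | nil => rw [pathMap_nil, pathMap_nil, Category.id_comp, Category.comp_id]
  | cons p α ih => rw [pathMap_cons, pathMap_cons, Category.assoc, h, reassoc_of% ih]

/-- A family of morphisms that is natural with respect to the arrows is a morphism of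
representations. -/
def homMk {F G : QuiverRep k V B} (u : ∀ i, vertex F i ⟶ vertex G i)
    (h : ∀ {i j : V} (α : i ⟶ j), arrow F α ≫ u j = u i ≫ arrow G α) : F ⟶ G :=
  ObjectProperty.homMk
    { app := fun i => u i
      naturality := fun i j f => by
        have := F.property.1
        have := F.property.2
        have := G.property.1
        have := G.property.2
        exact free_naturality (C := Paths V) (u i) (u j) (fun p => pathMap_naturality u h p) f }

@[simp]
lemma app_homMk {F G : QuiverRep k V B} (u : ∀ i, vertex F i ⟶ vertex G i)
    (h : ∀ {i j : V} (α : i ⟶ j), arrow F α ≫ u j = u i ≫ arrow G α) (i : V) :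
    app (homMk u h) i = u i := rfl

variable (k B) in
/-- Evaluation of representations at a vertex. -/
def evalAt (i : V) : QuiverRep k V B ⥤ B where
  obj F := vertex F i
  map φ := app φ i

instance (i : V) : (evalAt k B i).Additive where

instance (i : V) : PreservesFiniteLimits (evalAt k B i) := by
  have : PreservesFiniteLimits (isLinearFunctor k (QuiverLinearization k V) B).ι := by
    have := (isLinearFunctor k (QuiverLinearization k V) B).preservesKernels_ι
    exact Functor.preservesFiniteLimits_of_preservesKernels _
  exact inferInstanceAs (PreservesFiniteLimits
    ((isLinearFunctor k (QuiverLinearization k V) B).ι ⋙ (evaluation _ _).obj _))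

instance (i : V) : PreservesFiniteColimits (evalAt k B i) := by
  have : PreservesFiniteColimits (isLinearFunctor k (QuiverLinearization k V) B).ι := by
    have := (isLinearFunctor k (QuiverLinearization k V) B).preservesCokernels_ι
    exact Functor.preservesFiniteColimits_of_preservesCokernels _
  exact inferInstanceAs (PreservesFiniteColimits
    ((isLinearFunctor k (QuiverLinearization k V) B).ι ⋙ (evaluation _ _).obj _))

lemma isZero_of_vertex {F : QuiverRep k V B} (h : ∀ i, IsZero (vertex F i)) : IsZero F :=
  (IsZero.iff_id_eq_zero F).2 (hom_ext fun i => (h i).eq_of_src _ _)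

/-- Evaluation is exact, so homology is computed at each vertex, and vanishing is detected there. -/
lemma exact_of_evalAt {S : ShortComplex (QuiverRep k V B)}
    (h : ∀ i, (S.map (evalAt k B i)).Exact) : S.Exact := by
  rw [ShortComplex.exact_iff_isZero_homology]
  exact isZero_of_vertex fun i =>
    ((ShortComplex.exact_iff_isZero_homology _).1 (h i)).of_iso (S.mapHomologyIso (evalAt k B i)).symm

lemma mono_of_app {F G : QuiverRep k V B} (φ : F ⟶ G) (h : ∀ i, Mono (app φ i)) : Mono φ := by
  refine ⟨fun a b e => hom_ext fun i => ?_⟩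
  rw [← cancel_mono (app φ i), ← app_comp, e, app_comp]

lemma epi_of_app {F G : QuiverRep k V B} (φ : F ⟶ G) (h : ∀ i, Epi (app φ i)) : Epi φ := by
  refine ⟨fun a b e => hom_ext fun i => ?_⟩
  rw [← cancel_epi (app φ i), ← app_comp, e, app_comp]

instance {F G : QuiverRep k V B} (φ : F ⟶ G) [Mono φ] (i : V) : Mono (app φ i) :=
  inferInstanceAs (Mono ((evalAt k B i).map φ))

instance {F G : QuiverRep k V B} (φ : F ⟶ G) [Epi φ] (i : V) : Epi (app φ i) :=
  inferInstanceAs (Epi ((evalAt k B i).map φ))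

lemma shortExact_of_evalAt {S : ShortComplex (QuiverRep k V B)}
    (h : ∀ i, (S.map (evalAt k B i)).ShortExact) : S.ShortExact :=
  .mk' (exact_of_evalAt fun i => (h i).exact) (mono_of_app _ fun i => (h i).mono_f)
    (epi_of_app _ fun i => (h i).epi_g)

lemma app_comp_app_eq_zero (S : ShortComplex (QuiverRep k V B)) (i : V) :
    app S.f i ≫ app S.g i = 0 := by
  rw [← app_comp, S.zero, app_zero]

lemma app_shortExact {S : ShortComplex (QuiverRep k V B)} (hS : S.ShortExact) (i : V) :
    (ShortComplex.mk _ _ (app_comp_app_eq_zero S i)).ShortExact :=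
  hS.map_of_exact (evalAt k B i)

end QuiverRep
end

noncomputable section

namespace QuiverRep

variable {k : Type w} [CommRing k] {V : Type u₁} [Quiver.{v₁} V]
  {B : Type u₂} [Category.{v₂} B] [Abelian B] [Linear k B] [LocallyBoundedQuiver V]

attribute [local instance] Abelian.hasFiniteBiproducts

instance (j : V) : Finite (Σ i : V, Quiver.Path i j) :=
  LocallyBoundedQuiver.finite_paths_to j

instance (i j : V) : Finite (Quiver.Path i j) :=
  Finite.of_injective (fun p => (⟨i, p⟩ : Σ i : V, Quiver.Path i j))
    fun _ _ h => eq_of_heq (Sigma.mk.inj h).2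

/-! ### The functors sending a representation to its sources and its top. -/

section Incoming

@[simp]
lemma ι_incoming (F : QuiverRep k V B) (i : V) (α : Quiver.Costar i) :
    biproduct.ι (fun α : Quiver.Costar i => vertex F α.1) α ≫ incoming F i = arrow F α.2 :=
  biproduct.ι_desc _ _

/-- The object `⨁_{t(α) = i} F(s(α))`. -/
abbrev sourcesObj (F : QuiverRep k V B) (i : V) : B :=
  ⨁ fun α : Quiver.Costar i => vertex F α.1

/-- The morphism induced on `⨁_{t(α) = i} F(s(α))`. -/
abbrev sourcesMap {F G : QuiverRep k V B} (φ : F ⟶ G) (i : V) :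
    sourcesObj F i ⟶ sourcesObj G i :=
  biproduct.map fun α => app φ α.1

lemma sourcesMap_incoming {F G : QuiverRep k V B} (φ : F ⟶ G) (i : V) :
    sourcesMap φ i ≫ incoming G i = incoming F i ≫ app φ i := by
  apply biproduct.hom_ext'
  intro α
  rw [biproduct.ι_map_assoc, reassoc_of% @ι_incoming, ι_incoming, arrow_app]

lemma sourcesMap_add {F G : QuiverRep k V B} (φ ψ : F ⟶ G) (i : V) :
    sourcesMap (φ + ψ) i = sourcesMap φ i + sourcesMap ψ i := by
  apply biproduct.hom_ext
  intro α
  rw [Preadditive.add_comp]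
  simp only [biproduct.map_π, app_add, Preadditive.comp_add]

variable (k B) in
/-- The functor `F ↦ ⨁_{t(α) = i} F(s(α))`. -/
def sources (i : V) : QuiverRep k V B ⥤ B where
  obj F := sourcesObj F i
  map φ := sourcesMap φ i
  map_id F := biproduct.hom_ext _ _ fun α => by simp
  map_comp φ ψ := biproduct.hom_ext _ _ fun α => by simp

instance (i : V) : (sources k B i).Additive where
  map_add {_ _ φ ψ} := sourcesMap_add φ ψ i

variable (k B) in
/-- The morphisms `(f_α)_{t(α) = i}` as a natural transformation. -/
def incomingNatTrans (i : V) : sources k B i ⟶ evalAt k B i where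
  app F := incoming F i
  naturality _ _ φ := sourcesMap_incoming φ i

lemma map_sources_shortExact {S : ShortComplex (QuiverRep k V B)} (hS : S.ShortExact) (i : V) :
    (S.map (sources k B i)).ShortExact := by
  have hev := app_shortExact hS
  have hm (j : V) : Mono (app S.f j) := (hev j).mono_f
  have he (j : V) : Epi (app S.g j) := (hev j).epi_g
  have hmono : Mono (S.map (sources k B i)).f := inferInstanceAs (Mono (sourcesMap S.f i))
  have hepi : Epi (S.map (sources k B i)).g := inferInstanceAs (Epi (sourcesMap S.g i))
  refine .mk' ?_ hmono hepi
  refine ShortComplex.exact_of_f_is_kernel _ (KernelFork.IsLimit.ofι' _ _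
    fun {T} (l : T ⟶ sourcesObj S.X₂ i)
      (hl : l ≫ sourcesMap S.g i = 0) => ?_)
  have hl' (α : Quiver.Costar i) : (l ≫ biproduct.π _ α) ≫ app S.g α.1 = 0 := by
    rw [Category.assoc, ← biproduct.map_π (fun α : Quiver.Costar i => app S.g α.1),
      reassoc_of% hl, zero_comp]
  refine ⟨biproduct.lift fun α => (hev α.1).exact.lift _ (hl' α), ?_⟩
  change _ ≫ sourcesMap S.f i = l
  apply biproduct.hom_ext
  intro α
  rw [Category.assoc, biproduct.map_π, biproduct.lift_π_assoc]
  exact (hev α.1).exact.lift_f _ (hl' α)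

/-- The cokernel of `(f_α)_{t(α) = i}`. -/
abbrev top (F : QuiverRep k V B) (i : V) : B := cokernel (incoming F i)

/-- The morphism induced on the cokernels of `(f_α)_{t(α) = i}`. -/
abbrev topMap {F G : QuiverRep k V B} (φ : F ⟶ G) (i : V) : top F i ⟶ top G i :=
  cokernel.map _ _ (sourcesMap φ i) (app φ i) (sourcesMap_incoming φ i).symm

/-- The morphism of short complexes given by `(f_α)_{t(α) = i}`. -/
abbrev incomingHom (S : ShortComplex (QuiverRep k V B)) (i : V) :
    S.map (sources k B i) ⟶ S.map (evalAt k B i) :=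
  S.mapNatTrans (incomingNatTrans k B i)

lemma topMap_comp_eq_zero {S : ShortComplex (QuiverRep k V B)} (i : V) :
    topMap S.f i ≫ topMap S.g i = 0 :=
  (cokernelShortComplex (incomingHom S i)).zero

/-- The snake lemma for `incoming`: the obstruction to left exactness of `top` is the kernel of
`incoming S.X₃ i`. -/
lemma top_shortExact {S : ShortComplex (QuiverRep k V B)} (hS : S.ShortExact)
    (h : IsMonic S.X₃) (i : V) :
    (ShortComplex.mk _ _ (topMap_comp_eq_zero (S := S) i)).ShortExact := by
  have : Mono (incomingHom S i).τ₃ := h i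
  exact cokernelShortComplex_shortExact (incomingHom S i) (map_sources_shortExact hS i)
    (hS.map_of_exact (evalAt k B i))

lemma isMonic_of_mono_topMap {S : ShortComplex (QuiverRep k V B)} (hS : S.ShortExact)
    (h : IsMonic S.X₂) (h' : ∀ i, Mono (topMap S.f i)) : IsMonic S.X₃ := fun i => by
  have : Mono (incomingHom S i).τ₂ := h i
  have : Mono (cokernelShortComplex (incomingHom S i)).f := h' i
  exact mono_τ₃_of_mono_cokernel_map (incomingHom S i) (map_sources_shortExact hS i)
    (hS.map_of_exact (evalAt k B i))

lemma IsMonic.of_mono {F G : QuiverRep k V B} (hG : IsMonic G) (φ : F ⟶ G) [Mono φ] :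
    IsMonic F := fun i => by
  have := hG i
  have : Mono (incoming F i ≫ app φ i) := by
    rw [← sourcesMap_incoming]
    infer_instance
  exact mono_of_mono _ (app φ i)

end Incoming

lemma projective_biproduct {J : Type*} [Finite J] (X : J → B) [∀ j, Projective (X j)] :
    Projective (⨁ X) where
  factors f e _ := ⟨biproduct.desc fun j => Projective.factorThru (biproduct.ι X j ≫ f) e,
    biproduct.hom_ext' _ _ fun j => by simp⟩

/-! ### Free representations, left adjoint to taking the family of vertex objects. -/

section Induced

/-- The representation freely generated by objects `X i` at the vertices `i`. -/
def induced (X : V → B) : QuiverRep k V B :=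
  ofQuiver (fun j => ⨁ fun p : Σ i : V, Quiver.Path i j => X p.1)
    fun _ l α => biproduct.desc fun p =>
      biproduct.ι (fun p : Σ i : V, Quiver.Path i l => X p.1) ⟨p.1, p.2.cons α⟩

variable (k) in
/-- The inclusion of the copy of `X i` indexed by a path `p` starting in `i`. -/
def inducedι (X : V → B) {i j : V} (p : Quiver.Path i j) :
    X i ⟶ vertex (induced (k := k) X) j :=
  (biproduct.ι (fun p : Σ i : V, Quiver.Path i j => X p.1) ⟨i, p⟩ :
    X i ⟶ ⨁ fun p : Σ i : V, Quiver.Path i j => X p.1)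

lemma induced_hom_ext {X : V → B} {j : V} {T : B} {f g : vertex (induced (k := k) X) j ⟶ T}
    (h : ∀ i (p : Quiver.Path i j), inducedι k X p ≫ f = inducedι k X p ≫ g) : f = g :=
  biproduct.hom_ext' (f := fun p : Σ i : V, Quiver.Path i j => X p.1) _ _ fun p => h p.1 p.2

/-- A morphism out of `induced X` at a vertex. -/
def inducedVertexDesc {X : V → B} {j : V} {T : B} (f : ∀ i, Quiver.Path i j → (X i ⟶ T)) :
    vertex (induced (k := k) X) j ⟶ T :=
  (biproduct.desc fun p => f p.1 p.2 : (⨁ fun p : Σ i : V, Quiver.Path i j => X p.1) ⟶ T)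

@[simp]
lemma inducedι_vertexDesc {X : V → B} {j : V} {T : B} (f : ∀ i, Quiver.Path i j → (X i ⟶ T))
    {i : V} (p : Quiver.Path i j) :
    inducedι k X p ≫ inducedVertexDesc (k := k) f = f i p :=
  biproduct.ι_desc (f := fun p : Σ i : V, Quiver.Path i j => X p.1) (fun p => f p.1 p.2) ⟨i, p⟩

@[simp]
lemma inducedι_arrow (X : V → B) {i j l : V} (p : Quiver.Path i j) (α : j ⟶ l) :
    inducedι k X p ≫ arrow (induced X) α = inducedι k X (p.cons α) :=
  (inducedι k X p ≫= arrow_ofQuiver _ _ α).trans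
    (biproduct.ι_desc (f := fun p : Σ i : V, Quiver.Path i j => X p.1) _ ⟨i, p⟩)

lemma inducedι_pathMap (X : V → B) {i j l : V} (p : Quiver.Path i j) (q : Quiver.Path j l) :
    inducedι k X p ≫ pathMap (induced X) q = inducedι k X (p.comp q) := by
  induction q with
  | nil => rw [pathMap_nil, Category.comp_id, Quiver.Path.comp_nil]
  | cons q α ih => rw [pathMap_cons, reassoc_of% ih, inducedι_arrow, Quiver.Path.comp_cons]

/-- The morphism of representations `induced X ⟶ F` given by morphisms `X i ⟶ F i`. -/
def inducedDesc {X : V → B} {F : QuiverRep k V B} (f : ∀ i, X i ⟶ vertex F i) :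
    induced X ⟶ F :=
  homMk (fun _ => inducedVertexDesc fun i p => f i ≫ pathMap F p) fun {i j} α =>
    induced_hom_ext fun l p => by
      rw [reassoc_of% @inducedι_arrow, inducedι_vertexDesc, reassoc_of% @inducedι_vertexDesc, pathMap_cons,
        Category.assoc]

@[simp]
lemma inducedι_desc {X : V → B} {F : QuiverRep k V B} (f : ∀ i, X i ⟶ vertex F i) {i j : V}
    (p : Quiver.Path i j) : inducedι k X p ≫ app (inducedDesc f) j = f i ≫ pathMap F p :=
  inducedι_vertexDesc (fun i p => f i ≫ pathMap F p) p

lemma inducedι_nil_desc {X : V → B} {F : QuiverRep k V B} (f : ∀ i, X i ⟶ vertex F i) (i : V) :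
    inducedι k X .nil ≫ app (inducedDesc f) i = f i := by
  rw [inducedι_desc, pathMap_nil, Category.comp_id]

lemma inducedι_app {X : V → B} {F : QuiverRep k V B} (φ : induced X ⟶ F) {i j : V}
    (p : Quiver.Path i j) :
    inducedι k X p ≫ app φ j = inducedι k X .nil ≫ app φ i ≫ pathMap F p := by
  rw [← pathMap_app, reassoc_of% @inducedι_pathMap, Quiver.Path.nil_comp]

lemma induced_ext {X : V → B} {F : QuiverRep k V B} {φ ψ : induced X ⟶ F}
    (h : ∀ i, inducedι k X .nil ≫ app φ i = inducedι k X .nil ≫ app ψ i) : φ = ψ :=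
  hom_ext fun j => induced_hom_ext fun i p => by
    rw [inducedι_app, inducedι_app, reassoc_of% h i]

instance projective_induced (X : V → B) [∀ i, Projective (X i)] :
    Projective (induced (k := k) X) where
  factors {E F} f e _ := by
    refine ⟨inducedDesc fun i => Projective.factorThru (inducedι k X .nil ≫ app f i) (app e i),
      induced_ext fun i => ?_⟩
    rw [app_comp, ← Category.assoc, inducedι_nil_desc, Projective.factorThru_comp]

instance projective_vertex_induced (X : V → B) [∀ i, Projective (X i)] (j : V) :
    Projective (vertex (induced (k := k) X) j) :=
  projective_biproduct fun p : Σ i : V, Quiver.Path i j => X p.1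

variable (k) in
/-- The projection of `induced X` at `j` to the copy of `X j` of the trivial path. -/
def inducedProj (X : V → B) (j : V) : vertex (induced (k := k) X) j ⟶ X j :=
  inducedVertexDesc fun _ p => match p with
    | .nil => 𝟙 _
    | .cons _ _ => 0

@[simp]
lemma inducedι_nil_proj (X : V → B) (j : V) :
    inducedι k X (.nil : Quiver.Path j j) ≫ inducedProj k X j = 𝟙 _ :=
  inducedι_vertexDesc _ _

@[simp]
lemma inducedι_cons_proj (X : V → B) {i l j : V} (p : Quiver.Path i l) (α : l ⟶ j) :
    inducedι k X (p.cons α) ≫ inducedProj k X j = 0 :=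
  inducedι_vertexDesc _ _

variable (k) in
/-- The projection of `induced X` at `j` to the copies of nontrivial paths. -/
def inducedRetraction (X : V → B) (j : V) :
    vertex (induced (k := k) X) j ⟶
      ⨁ fun α : Quiver.Costar j => vertex (induced (k := k) X) α.1 :=
  inducedVertexDesc fun _ p => match p with
    | .nil => 0
    | .cons (b := b) q α => inducedι k X q ≫
        biproduct.ι (fun α : Quiver.Costar j => vertex (induced (k := k) X) α.1) ⟨b, α⟩

@[simp]
lemma inducedι_nil_retraction (X : V → B) (j : V) :
    inducedι k X (.nil : Quiver.Path j j) ≫ inducedRetraction k X j = 0 :=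
  inducedι_vertexDesc _ _

@[simp]
lemma inducedι_cons_retraction (X : V → B) {i l j : V} (p : Quiver.Path i l) (α : l ⟶ j) :
    inducedι k X (p.cons α) ≫ inducedRetraction k X j = inducedι k X p ≫
      biproduct.ι (fun α : Quiver.Costar j => vertex (induced (k := k) X) α.1) ⟨l, α⟩ :=
  inducedι_vertexDesc _ _

lemma incoming_inducedProj (X : V → B) (j : V) :
    incoming (induced X) j ≫ inducedProj k X j = 0 := by
  apply biproduct.hom_ext'
  intro α
  apply induced_hom_ext
  intro i p
  rw [reassoc_of% @ι_incoming, reassoc_of% @inducedι_arrow, inducedι_cons_proj, comp_zero,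
    comp_zero]

/-- The sequence `0 ⟶ ⨁_{t(α) = j} F(s(α)) ⟶ F(j) ⟶ X(j) ⟶ 0` for `F = induced X` splits. -/
def inducedSplitting (X : V → B) (j : V) :
    (ShortComplex.mk _ _ (incoming_inducedProj (k := k) X j)).Splitting where
  r := inducedRetraction k X j
  s := inducedι k X .nil
  f_r := by
    apply biproduct.hom_ext'
    intro α
    apply induced_hom_ext
    intro i p
    dsimp
    rw [reassoc_of% @ι_incoming, reassoc_of% @inducedι_arrow, inducedι_cons_retraction, Category.comp_id]
  s_g := inducedι_nil_proj X j
  id := by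
    apply induced_hom_ext
    rintro i (_ | ⟨p, α⟩)
    · dsimp
      rw [Preadditive.comp_add, reassoc_of% @inducedι_nil_retraction, zero_comp, zero_add,
        reassoc_of% @inducedι_nil_proj, Category.comp_id]
    · dsimp
      rw [Preadditive.comp_add, reassoc_of% @inducedι_cons_retraction, ι_incoming, inducedι_arrow,
        reassoc_of% @inducedι_cons_proj, zero_comp, add_zero, Category.comp_id]

lemma isMonic_induced (X : V → B) : IsMonic (induced (k := k) X) := fun j =>
  (inducedSplitting (k := k) X j).shortExact.mono_f

variable (k) in
/-- The cokernel of `(f_α)_{t(α) = i}` for `induced X` is `X i`. -/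
def topInducedIso (X : V → B) (j : V) : top (induced (k := k) X) j ≅ X j :=
  (cokernelIsCokernel _).coconePointUniqueUpToIso (inducedSplitting (k := k) X j).gIsCokernel

@[simp]
lemma π_topInducedIso_hom (X : V → B) (j : V) :
    cokernel.π (incoming (induced X) j) ≫ (topInducedIso k X j).hom = inducedProj k X j :=
  (cokernelIsCokernel _).comp_coconePointUniqueUpToIso_hom
    (inducedSplitting (k := k) X j).gIsCokernel WalkingParallelPair.one

end Induced

/-! ### The standard resolution of length one. -/

section Resolution

variable (T : QuiverRep k V B)

/-- The counit `induced T ⟶ T`. -/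
def counit : induced (k := k) (vertex T) ⟶ T := inducedDesc fun i => 𝟙 (vertex T i)

/-- The morphism `induced (⨁_{t(α) = i} T(s(α))) ⟶ induced T` of the standard resolution. -/
def resolutionHom : induced (k := k) (sourcesObj T) ⟶ induced (vertex T) :=
  inducedDesc fun _ => biproduct.desc fun α =>
    inducedι k (vertex T) α.2.toPath - arrow T α.2 ≫ inducedι k (vertex T) .nil

/-- The retraction of `resolutionHom` on the copy of a path. -/
def resolutionHomotopy {i : V} : ∀ {j : V}, Quiver.Path i j →
    (vertex T i ⟶ vertex (induced (k := k) (sourcesObj T)) j)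
  | _, .nil => 0
  | j, .cons (b := b) p α => resolutionHomotopy p ≫ arrow _ α + pathMap T p ≫
      biproduct.ι (fun α : Quiver.Costar j => vertex T α.1) ⟨b, α⟩ ≫
        inducedι k (sourcesObj T) .nil

/-- The definition peels off the last arrow of a path, whereas `resolutionHom` prepends arrows; this
is the recursion at the other end, needed for the retraction identity. -/
lemma resolutionHomotopy_comp {h i j : V} (α : h ⟶ i) (p : Quiver.Path i j) :
    resolutionHomotopy T (α.toPath.comp p) = arrow T α ≫ resolutionHomotopy T p +
      biproduct.ι (fun α : Quiver.Costar i => vertex T α.1) ⟨h, α⟩ ≫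
        inducedι k (sourcesObj T) p := by
  induction p with
  | nil =>
    rw [Quiver.Path.comp_nil, Quiver.Hom.toPath]
    simp only [resolutionHomotopy, pathMap_nil]
    simp
  | cons p β ih =>
    rw [Quiver.Path.comp_cons]
    simp only [resolutionHomotopy, ih, pathMap_comp, pathMap_toPath, Preadditive.add_comp,
      Preadditive.comp_add, Category.assoc]
    rw [inducedι_arrow]
    abel

lemma resolution_w : resolutionHom T ≫ counit T = 0 := by
  apply induced_ext
  intro i
  apply biproduct.hom_ext'
  intro α
  rw [app_comp, resolutionHom, ← Category.assoc (inducedι _ _ _), inducedι_nil_desc, 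
    biproduct.ι_desc_assoc, Preadditive.sub_comp, counit, Category.assoc, inducedι_desc, inducedι_nil_desc, pathMap_toPath]
  simp

lemma inducedι_nil_resolutionHom {i h : V} (α : h ⟶ i) :
    biproduct.ι (fun α : Quiver.Costar i => vertex T α.1) ⟨h, α⟩ ≫
      inducedι k (sourcesObj T) .nil ≫ app (resolutionHom T) i =
    inducedι k (vertex T) α.toPath - arrow T α ≫ inducedι k (vertex T) .nil := by
  rw [resolutionHom, inducedι_nil_desc, biproduct.ι_desc]

/-- Moving the arrows of `p` one at a time from the path into `T` gives a telescoping sum, each term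
of which lies in the image of `resolutionHom`. -/
lemma resolutionHomotopy_resolutionHom {i j : V} (p : Quiver.Path i j) :
    resolutionHomotopy T p ≫ app (resolutionHom T) j + pathMap T p ≫ inducedι k (vertex T) .nil =
      inducedι k (vertex T) p := by
  induction p with
  | nil => rw [resolutionHomotopy, zero_comp, pathMap_nil, Category.id_comp, zero_add]
  | cons p α ih =>
    have e := ih =≫ arrow _ α
    rw [Preadditive.add_comp, Category.assoc, Category.assoc, inducedι_arrow, inducedι_arrow] at e
    rw [resolutionHomotopy, Preadditive.add_comp]
    simp only [Category.assoc]
    rw [arrow_app, inducedι_nil_resolutionHom, pathMap_cons, ← e, Preadditive.comp_sub,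
      Quiver.Hom.toPath, Category.assoc]
    abel

lemma app_resolution_w (j : V) : app (resolutionHom T) j ≫ app (counit T) j = 0 := by
  rw [← app_comp, resolution_w, app_zero]

/-- The standard resolution splits at every vertex. -/
def resolutionSplitting (j : V) : (ShortComplex.mk _ _ (app_resolution_w T j)).Splitting where
  r := inducedVertexDesc fun _ p => resolutionHomotopy T p
  s := inducedι k (vertex T) .nil
  f_r := by
    apply induced_hom_ext
    intro i p
    apply biproduct.hom_ext'
    intro α
    dsimp
    rw [resolutionHom, reassoc_of% @inducedι_desc, Category.comp_id, biproduct.ι_desc_assoc,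
      Preadditive.sub_comp, Category.assoc, reassoc_of% @inducedι_pathMap, reassoc_of% @inducedι_pathMap,
      inducedι_vertexDesc, inducedι_vertexDesc, resolutionHomotopy_comp, Quiver.Path.nil_comp]
    simp
  s_g := inducedι_nil_desc (fun i => 𝟙 (vertex T i)) j
  id := by
    apply induced_hom_ext
    intro i p
    dsimp
    rw [Preadditive.comp_add, reassoc_of% @inducedι_vertexDesc, counit, reassoc_of% @inducedι_desc,
      Category.comp_id, Category.id_comp, resolutionHomotopy_resolutionHom]

/-- The standard resolution `0 ⟶ induced (⨁_{t(α) = i} T(s(α))) ⟶ induced T ⟶ T ⟶ 0`. -/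
lemma resolution_shortExact : (ShortComplex.mk _ _ (resolution_w T)).ShortExact :=
  shortExact_of_evalAt fun j => (resolutionSplitting T j).shortExact

instance epi_counit : Epi (counit T) := (resolution_shortExact T).epi_g

end Resolution
end QuiverRep
end

noncomputable section

lemma ShortComplex.ShortExact.nonempty_iso_X₁ {A : Type u} [Category.{v} A] [Abelian A]
    {S S' : ShortComplex A} (hS : S.ShortExact) (hS' : S'.ShortExact) (e₂ : S.X₂ ≅ S'.X₂)
    (e₃ : S.X₃ ≅ S'.X₃) (h : S.g ≫ e₃.hom = e₂.hom ≫ S'.g) : Nonempty (S.X₁ ≅ S'.X₁) := by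
  have := hS.mono_f
  have := hS'.mono_f
  have h' : S'.g ≫ e₃.inv = e₂.inv ≫ S.g := by
    rw [Iso.eq_inv_comp, ← reassoc_of% h, e₃.hom_inv_id, Category.comp_id]
  obtain ⟨a, ha⟩ := hS'.exact.lift' (S.f ≫ e₂.hom) (by
    rw [Category.assoc, ← h, S.zero_assoc, zero_comp])
  obtain ⟨b, hb⟩ := hS.exact.lift' (S'.f ≫ e₂.inv) (by
    rw [Category.assoc, ← h', S'.zero_assoc, zero_comp])
  refine ⟨⟨a, b, ?_, ?_⟩⟩
  · rw [← cancel_mono S.f, Category.assoc, hb, reassoc_of% ha, e₂.hom_inv_id]; simp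
  · rw [← cancel_mono S'.f, Category.assoc, ha, reassoc_of% hb, e₂.inv_hom_id]; simp

lemma ShortComplex.ShortExact.nonempty_iso_X₃ {A : Type u} [Category.{v} A] [Abelian A]
    {S S' : ShortComplex A} (hS : S.ShortExact) (hS' : S'.ShortExact) (e₁ : S.X₁ ≅ S'.X₁)
    (e₂ : S.X₂ ≅ S'.X₂) (h : S.f ≫ e₂.hom = e₁.hom ≫ S'.f) : Nonempty (S.X₃ ≅ S'.X₃) := by
  have := hS.epi_g
  have := hS'.epi_g
  have h' : S'.f ≫ e₂.inv = e₁.inv ≫ S.f := by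
    rw [Iso.eq_inv_comp, ← reassoc_of% h, e₂.hom_inv_id, Category.comp_id]
  obtain ⟨a, ha⟩ := hS.exact.desc' (e₂.hom ≫ S'.g) (by rw [reassoc_of% h, S'.zero, comp_zero])
  obtain ⟨b, hb⟩ := hS'.exact.desc' (e₂.inv ≫ S.g) (by rw [reassoc_of% h', S.zero, comp_zero])
  refine ⟨⟨a, b, ?_, ?_⟩⟩
  · rw [← cancel_epi S.g, reassoc_of% ha, hb, e₂.hom_inv_id_assoc]; simp
  · rw [← cancel_epi S'.g, reassoc_of% hb, ha, e₂.inv_hom_id_assoc]; simp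

/-- Dependent choice along a well-founded relation. -/
lemma WellFounded.exists_family {α : Type*} {r : α → α → Prop} (wf : WellFounded r)
    {β : α → Type*} (R : ∀ i, (∀ i', r i' i → β i') → β i → Prop)
    (h : ∀ i f, ∃ b, R i f b) : ∃ f : ∀ i, β i, ∀ i, R i (fun i' _ => f i') (f i) := by
  choose b hb using h
  refine ⟨wf.fix b, fun i => ?_⟩
  rw [wf.fix_eq]
  exact hb i _

namespace QuiverRep

variable {k : Type w} [CommRing k] {V : Type u₁} [Quiver.{v₁} V]
  {B : Type u₂} [Category.{v₂} B] [Abelian B] [Linear k B]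

/-! ### Discrete representations and induction along arrows. -/

section Discrete

/-- The representation with objects `M i` at the vertices in which all arrows act by zero. -/
def discrete (M : V → B) : QuiverRep k V B := ofQuiver M fun _ _ _ => 0

variable (k) in
/-- The object at `i` of `discrete M` is `M i`. -/
def discreteIso (M : V → B) (i : V) : vertex (discrete (k := k) M) i ≅ M i := Iso.refl _

lemma arrow_discrete (M : V → B) {i j : V} (α : i ⟶ j) : arrow (discrete (k := k) M) α = 0 :=
  arrow_ofQuiver _ _ α

/-- Morphisms to a discrete representation. -/
def discreteLift {F : QuiverRep k V B} {M : V → B} (u : ∀ i, vertex F i ⟶ M i)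
    (h : ∀ {i j : V} (α : i ⟶ j), arrow F α ≫ u j = 0) : F ⟶ discrete M :=
  homMk (fun i => u i ≫ (discreteIso k M i).inv) fun α => by
    rw [arrow_discrete, comp_zero, reassoc_of% h α, zero_comp]

lemma app_discreteLift {F : QuiverRep k V B} {M : V → B} (u : ∀ i, vertex F i ⟶ M i)
    (h : ∀ {i j : V} (α : i ⟶ j), arrow F α ≫ u j = 0) (i : V) :
    app (discreteLift u h) i = u i ≫ (discreteIso k M i).inv := rfl

lemma arrow_app_discrete {F : QuiverRep k V B} {M : V → B} (φ : F ⟶ discrete M) {i j : V}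
    (α : i ⟶ j) : arrow F α ≫ app φ j = 0 := by
  rw [arrow_app, arrow_discrete, comp_zero]

lemma projective_vertex_kernel {F G : QuiverRep k V B} (φ : F ⟶ G) [Epi φ] (i : V)
    [Projective (vertex F i)] [Projective (vertex G i)] : Projective (vertex (kernel φ) i) :=
  have : Projective (ShortComplex.mk _ _ (app_comp_app_eq_zero
    (ShortComplex.mk (kernel.ι φ) φ (kernel.condition φ)) i)).X₃ := ‹Projective (vertex G i)›
  let σ := (app_shortExact (kernel_shortExact φ) i).splittingOfProjective
  Retract.projective (Y := vertex F i) ⟨app (kernel.ι φ) i, σ.r, σ.f_r⟩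

end Discrete

variable [LocallyBoundedQuiver V]

attribute [local instance] Abelian.hasFiniteBiproducts

variable (V) in
-- Appending an arrow `i ⟶ j` injects the paths ending in `i` into those ending in `j` and misses
-- the trivial path, so the finite number of incoming paths grows strictly.
lemma wellFounded_arrow : WellFounded fun i j : V => Nonempty (i ⟶ j) := by
  refine Subrelation.wf ?_
    (InvImage.wf (fun j : V => Nat.card (Σ i : V, Quiver.Path i j)) Nat.lt_wfRel.wf)
  rintro i j ⟨α⟩
  have := Fintype.ofFinite (Σ l : V, Quiver.Path l i)
  have := Fintype.ofFinite (Σ l : V, Quiver.Path l j)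
  change Nat.card _ < Nat.card _
  rw [Nat.card_eq_fintype_card, Nat.card_eq_fintype_card]
  refine Fintype.card_lt_of_injective_of_notMem
    (fun p : Σ l : V, Quiver.Path l i => (⟨p.1, p.2.cons α⟩ : Σ l : V, Quiver.Path l j)) ?_
    (b := ⟨j, .nil⟩) ?_
  · rintro ⟨l, p⟩ ⟨l', p'⟩ h
    obtain ⟨rfl, h⟩ := Sigma.mk.inj h
    have := Quiver.Path.heq_of_cons_eq_cons (eq_of_heq h)
    simpa using this
  · rintro ⟨⟨l, p⟩, h⟩
    obtain ⟨rfl, h⟩ := Sigma.mk.inj h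
    exact Quiver.Path.nil_ne_cons _ _ (eq_of_heq h).symm


section InducedDiscrete

variable (k) in
/-- The canonical morphism `induced X ⟶ discrete X`. -/
def inducedToDiscrete (X : V → B) : induced (k := k) X ⟶ discrete X :=
  inducedDesc fun i => (discreteIso k X i).inv

lemma app_inducedToDiscrete (X : V → B) (i : V) :
    app (inducedToDiscrete k X) i = inducedProj k X i ≫ (discreteIso k X i).inv := by
  apply induced_hom_ext
  rintro j (_ | ⟨p, α⟩)
  · rw [inducedToDiscrete, inducedι_nil_desc, reassoc_of% @inducedι_nil_proj]
  · rw [inducedToDiscrete, inducedι_desc, pathMap_cons, arrow_discrete, comp_zero, comp_zero,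
      reassoc_of% @inducedι_cons_proj, zero_comp]

instance (X : V → B) (i : V) : IsSplitEpi (inducedProj k X i) :=
  (inducedSplitting X i).isSplitEpi_g

instance epi_inducedToDiscrete (X : V → B) : Epi (inducedToDiscrete k X) :=
  epi_of_app _ fun i => by
    rw [app_inducedToDiscrete]
    exact epi_comp _ _

end InducedDiscrete

/-! ### Projective representations as retracts of free ones. -/

section Projective

@[simp]
lemma π_topMap {F G : QuiverRep k V B} (φ : F ⟶ G) (i : V) :
    cokernel.π (incoming F i) ≫ topMap φ i = app φ i ≫ cokernel.π (incoming G i) :=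
  cokernel.π_desc _ _ _

lemma topMap_id (F : QuiverRep k V B) (i : V) : topMap (𝟙 F) i = 𝟙 _ := by
  rw [← cancel_epi (cokernel.π _), π_topMap]
  simp

lemma topMap_comp {F G H : QuiverRep k V B} (φ : F ⟶ G) (ψ : G ⟶ H) (i : V) :
    topMap (φ ≫ ψ) i = topMap φ i ≫ topMap ψ i := by
  rw [← cancel_epi (cokernel.π _), π_topMap, reassoc_of% @π_topMap, π_topMap, app_comp, Category.assoc]

lemma arrow_π_top (F : QuiverRep k V B) {i j : V} (α : j ⟶ i) :
    arrow F α ≫ cokernel.π (incoming F i) = 0 := by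
  rw [← ι_incoming F i ⟨j, α⟩, Category.assoc, cokernel.condition, comp_zero]

variable [EnoughProjectives B]

/-- Projective representations are retracts of freely generated ones. -/
lemma exists_retract_induced (P : QuiverRep k V B) [Projective P] :
    ∃ X : V → B, (∀ i, Projective (X i)) ∧ Nonempty (Retract P (induced X)) := by
  let π : induced (fun i => Projective.over (vertex P i)) ⟶ P :=
    inducedDesc fun i => Projective.π (vertex P i)
  have : Epi π := epi_of_app _ fun i => by
    have : Epi (inducedι k _ .nil ≫ app π i) := by
      rw [inducedι_nil_desc]
      infer_instance
    exact epi_of_epi (inducedι k _ .nil) _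
  exact ⟨_, fun i => inferInstance, ⟨⟨Projective.factorThru (𝟙 P) π, π,
    Projective.factorThru_comp _ _⟩⟩⟩

lemma isMonic_of_projective (P : QuiverRep k V B) [Projective P] : IsMonic P := by
  obtain ⟨X, hX, ⟨r⟩⟩ := exists_retract_induced P
  exact (isMonic_induced X).of_mono r.i

lemma projective_vertex (P : QuiverRep k V B) [Projective P] (i : V) :
    Projective (vertex P i) := by
  obtain ⟨X, hX, ⟨r⟩⟩ := exists_retract_induced P
  exact Retract.projective (Y := vertex (induced (k := k) X) i)
    ⟨app r.i i, app r.r i, by rw [← app_comp, r.retract, app_id]⟩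

lemma projective_top (P : QuiverRep k V B) [Projective P] (i : V) : Projective (top P i) := by
  obtain ⟨X, hX, ⟨r⟩⟩ := exists_retract_induced P
  have : Projective (top (induced (k := k) X) i) :=
    Projective.of_iso (topInducedIso k X i).symm inferInstance
  exact Retract.projective (Y := top (induced (k := k) X) i)
    ⟨topMap r.i i, topMap r.r i, by rw [← topMap_comp, r.retract, topMap_id]⟩

end Projective

/-! ### Ext vanishing for monic representations. -/

section Gorenstein

/-- `Ext¹(F, N) = 0` if `F` is monic with Gorenstein projective cokernels and `N` is projective at
every vertex. -/
lemma extVanishes_of_isMonic {F : QuiverRep k V B} (hF : IsMonic F)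
    (hF' : ∀ i, IsGorensteinProjective (top F i)) (N : QuiverRep k V B)
    [hN : ∀ i, Projective (vertex N i)] : ExtVanishes F N := by
  intro E ι p w hS
  obtain ⟨s, hs⟩ := (wellFounded_arrow V).exists_family
    (β := fun i => {s : vertex F i ⟶ vertex E i // s ≫ app p i = 𝟙 _})
    (fun i f s => ∀ (j : V) (α : j ⟶ i), arrow F α ≫ s.1 = (f j ⟨α⟩).1 ≫ arrow E α) (by
      intro i f
      have := hF i
      -- Compatibility with the arrows into `i` prescribes the section on the image of `incoming F
      -- i`. It extends to `F(i)` because Ext¹ from the top to `N(i)` vanishes.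
      let s₀ : sourcesObj F i ⟶ vertex E i :=
        biproduct.desc fun α => (f α.1 ⟨α.2⟩).1 ≫ arrow E α.2
      have hs₀ : s₀ ≫ app p i = incoming F i := by
        apply biproduct.hom_ext'
        intro α
        rw [biproduct.ι_desc_assoc, Category.assoc, arrow_app, ← Category.assoc,
          (f α.1 ⟨α.2⟩).2, Category.id_comp, ι_incoming]
      obtain ⟨s, hs, hs'⟩ := ExtVanishes.exists_section (cokernel_shortExact (incoming F i))
        (app_shortExact hS i) ((hF' i).extVanishes (vertex N i)) s₀ hs₀
      refine ⟨⟨s, hs⟩, fun j α => ?_⟩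
      dsimp at hs' ⊢
      rw [← ι_incoming F i ⟨j, α⟩, Category.assoc, hs', biproduct.ι_desc])
  let σ : F ⟶ E := homMk (fun i => (s i).1) fun α => hs _ _ α
  have hσ : σ ≫ p = 𝟙 F := hom_ext fun i => (s i).2
  have := hS.mono_f
  let t := ShortComplex.Splitting.ofExactOfSection _ hS.exact σ hσ this
  exact ⟨t.r, t.f_r⟩

end Gorenstein

end QuiverRep
end

noncomputable section

namespace QuiverRep

variable {k : Type w} [CommRing k] {V : Type u₁} [Quiver.{v₁} V]
  {B : Type u₂} [Category.{v₂} B] [Abelian B] [Linear k B]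

attribute [local instance] Abelian.hasFiniteBiproducts

section Simple

variable (k) in
/-- The representation with the object `Q` at the vertex `i` and zero elsewhere. -/
abbrev simple (i : V) (Q : B) : QuiverRep k V B := discrete fun j => ⨁ fun _ : PLift (j = i) => Q

variable (k) in
/-- The projection of `simple k i Q` at the vertex `i` to `Q`. -/
def simpleProj (i : V) (Q : B) : vertex (simple k i Q) i ⟶ Q :=
  (discreteIso k _ i).hom ≫ biproduct.π (fun _ : PLift (i = i) => Q) ⟨rfl⟩

/-- Half of the adjunction between the top at `i` and `simple k i`: `hf` says that `f` factors
through the top. -/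
lemma exists_simpleLift {F : QuiverRep k V B} (i : V) {Q : B} (f : vertex F i ⟶ Q)
    (hf : ∀ {j : V} (α : j ⟶ i), arrow F α ≫ f = 0) :
    ∃ φ : F ⟶ simple k i Q, app φ i ≫ simpleProj k i Q = f := by
  let u (j : V) : vertex F j ⟶ ⨁ fun _ : PLift (j = i) => Q :=
    biproduct.lift fun h => eqToHom (by rw [h.down]) ≫ f
  have hu {j l : V} (α : j ⟶ l) : arrow F α ≫ u l = 0 := by
    apply biproduct.hom_ext
    rintro ⟨rfl⟩
    rw [Category.assoc, biproduct.lift_π, eqToHom_refl, Category.id_comp, hf, zero_comp]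
  have hu' : u i ≫ biproduct.π (fun _ : PLift (i = i) => Q) ⟨rfl⟩ = f := by
    rw [biproduct.lift_π, eqToHom_refl, Category.id_comp]
  refine ⟨discreteLift u hu, (app_discreteLift u hu i =≫ simpleProj k i Q).trans ?_⟩
  rw [simpleProj, Category.assoc, Iso.inv_hom_id_assoc, hu']

end Simple

variable [LocallyBoundedQuiver V]

/-! ### Monic with Gorenstein projective cokernels implies Gorenstein projective. -/

section MonicWithGorensteinCokernels

/-- The morphism from `⨁_{t(α) = i} F(s(α)) ⟶ F(i) ⟶ top F i` induced by a morphism of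
representations. -/
def incomingSequenceMap {F G : QuiverRep k V B} (φ : F ⟶ G) (i : V) :
    ShortComplex.mk (incoming F i) (cokernel.π (incoming F i)) (cokernel.condition _) ⟶
      ShortComplex.mk (incoming G i) (cokernel.π (incoming G i)) (cokernel.condition _) where
  τ₁ := sourcesMap φ i
  τ₂ := app φ i
  τ₃ := topMap φ i
  comm₁₂ := sourcesMap_incoming φ i
  comm₂₃ := (π_topMap φ i).symm

/-- Induction along arrows: at `i` the map on sources is mono by induction and the map on tops by
assumption, so the four lemma gives the middle. -/
lemma mono_of_mono_topMap {F G : QuiverRep k V B} (φ : F ⟶ G) (hF : IsMonic F) (hG : IsMonic G)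
    (h : ∀ i, Mono (topMap φ i)) : Mono φ := by
  refine mono_of_app φ fun i => ?_
  induction i using (wellFounded_arrow V).induction with
  | _ i ih =>
    have hs (α : Quiver.Costar i) : Mono (app φ α.1) := ih α.1 ⟨α.2⟩
    have h₁ : Mono (incomingSequenceMap φ i).τ₁ := inferInstanceAs (Mono (sourcesMap φ i))
    have h₃ : Mono (incomingSequenceMap φ i).τ₃ := h i
    have := hF i
    have := hG i
    exact ShortComplex.mono_τ₂_of_exact_of_mono (incomingSequenceMap φ i)
      (ShortComplex.exact_cokernel _)

/-- A Nakayama lemma, by the dual argument. -/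
lemma epi_of_epi_topMap {F G : QuiverRep k V B} (φ : F ⟶ G) (h : ∀ i, Epi (topMap φ i)) :
    Epi φ := by
  refine epi_of_app φ fun i => ?_
  induction i using (wellFounded_arrow V).induction with
  | _ i ih =>
    have hs (α : Quiver.Costar i) : Epi (app φ α.1) := ih α.1 ⟨α.2⟩
    have h₁ : Epi (incomingSequenceMap φ i).τ₁ := inferInstanceAs (Epi (sourcesMap φ i))
    have h₃ : Epi (incomingSequenceMap φ i).τ₃ := h i
    exact ShortComplex.epi_τ₂_of_exact_of_epi (incomingSequenceMap φ i)
      (ShortComplex.exact_cokernel _)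

variable [EnoughProjectives B]

lemma isGorensteinStep_of_shortExact {S : ShortComplex (QuiverRep k V B)} (hS : S.ShortExact)
    [Projective S.X₂] (h : IsMonic S.X₃) (h' : ∀ i, IsGorensteinProjective (top S.X₃ i)) :
    IsGorensteinStep S.f S.g where
  projective := inferInstance
  w := S.zero
  shortExact := hS
  extend Q _ f := by
    have := projective_vertex Q
    exact (extVanishes_of_isMonic h h' Q).exists_extension hS f

/-- A representation that is monic with Gorenstein projective cokernels is a quotient of a
projective one by another such representation. -/
lemma exists_left_of_isMonic {F : QuiverRep k V B} (hF : IsMonic F)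
    (hF' : ∀ i, IsGorensteinProjective (top F i)) :
    ∃ (G P : QuiverRep k V B) (ι : G ⟶ P) (π : P ⟶ F),
      (IsMonic G ∧ ∀ i, IsGorensteinProjective (top G i)) ∧ IsGorensteinStep ι π := by
  choose Y P ι π hY hstep using fun i => (hF' i).exists_left
  have hP (i : V) : Projective (P i) := (hstep i).projective
  have hπ (i : V) : Epi (π i) := (hstep i).shortExact.epi_g
  let φ : induced P ⟶ F :=
    inducedDesc fun i => Projective.factorThru (π i) (cokernel.π (incoming F i))
  have hφ (i : V) : topMap φ i = (topInducedIso k P i).hom ≫ π i := by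
    rw [← cancel_epi (cokernel.π _), π_topMap, reassoc_of% @π_topInducedIso_hom]
    apply induced_hom_ext
    rintro j (_ | ⟨p, α⟩)
    · rw [← Category.assoc, inducedι_nil_desc, Projective.factorThru_comp,
        reassoc_of% @inducedι_nil_proj]
    · rw [← Category.assoc, inducedι_desc, pathMap_cons, reassoc_of% @inducedι_cons_proj, zero_comp]
      simp only [Category.assoc]
      rw [arrow_π_top, comp_zero, comp_zero]
  have : Epi φ := epi_of_epi_topMap φ fun i => by
    rw [hφ]
    infer_instance
  have hS := kernel_shortExact φ
  refine ⟨kernel φ, induced P, kernel.ι φ, φ, ⟨(isMonic_induced P).of_mono (kernel.ι φ),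
    fun i => ?_⟩, isGorensteinStep_of_shortExact hS hF hF'⟩
  -- The tops of the kernel sequence reproduce the chosen step in `B`, so the top of the kernel is
  -- `Y i`.
  obtain ⟨e⟩ := ShortComplex.ShortExact.nonempty_iso_X₁ (top_shortExact hS hF i)
    (hstep i).shortExact (topInducedIso k P i) (Iso.refl _) (by
      rw [Iso.refl_hom]
      exact (Category.comp_id _).trans (hφ i))
  exact (hY i).of_iso e.symm

/-- A representation that is monic with Gorenstein projective cokernels embeds into a projective
one with a quotient of the same kind. -/
lemma exists_right_of_isMonic {F : QuiverRep k V B} (hF : IsMonic F)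
    (hF' : ∀ i, IsGorensteinProjective (top F i)) :
    ∃ (P G : QuiverRep k V B) (ι : F ⟶ P) (π : P ⟶ G),
      (IsMonic G ∧ ∀ i, IsGorensteinProjective (top G i)) ∧ IsGorensteinStep ι π := by
  choose P Y ι π hY hstep using fun i => (hF' i).exists_right
  have hP (i : V) : Projective (P i) := (hstep i).projective
  have hι (i : V) : Mono (ι i) := (hstep i).shortExact.mono_f
  have hN (i : V) : Projective (vertex (kernel (inducedToDiscrete k P)) i) :=
    have : Projective (vertex (discrete (k := k) P) i) := hP i
    projective_vertex_kernel _ _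
  -- The embeddings `ι i` of the tops define a morphism from `F` to `discrete P`. It lifts to
  -- `induced P` because the kernel of `inducedToDiscrete` is projective at every vertex.
  obtain ⟨φ, hφ⟩ := (extVanishes_of_isMonic hF hF' _).exists_lift
    (kernel_shortExact (inducedToDiscrete k P))
    (discreteLift (fun i => cokernel.π (incoming F i) ≫ ι i) fun {i j} α => by
      rw [← Category.assoc, arrow_π_top, zero_comp])
  dsimp at φ hφ
  have hφ' (i : V) : topMap φ i ≫ (topInducedIso k P i).hom = ι i := by
    rw [← cancel_epi (cokernel.π _), reassoc_of% @π_topMap, π_topInducedIso_hom,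
      ← cancel_mono (discreteIso k P i).inv, Category.assoc, ← app_inducedToDiscrete, ← app_comp,
      hφ, app_discreteLift]
  have hmono (i : V) : Mono (topMap φ i) := by
    have : Mono (topMap φ i ≫ (topInducedIso k P i).hom) := by
      rw [hφ']
      infer_instance
    exact mono_of_mono _ (topInducedIso k P i).hom
  have : Mono φ := mono_of_mono_topMap φ hF (isMonic_induced P) hmono
  have hS := cokernel_shortExact φ
  have hG : IsMonic (cokernel φ) := isMonic_of_mono_topMap hS (isMonic_induced P) hmono
  have hG' (i : V) : IsGorensteinProjective (top (cokernel φ) i) := by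
    obtain ⟨e⟩ := ShortComplex.ShortExact.nonempty_iso_X₃ (top_shortExact hS hG i)
      (hstep i).shortExact (Iso.refl _) (topInducedIso k P i) (by
        rw [Iso.refl_hom]
        exact (hφ' i).trans (Category.id_comp _).symm)
    exact (hY i).of_iso e.symm
  exact ⟨induced P, cokernel φ, φ, cokernel.π φ, ⟨hG, hG'⟩,
    isGorensteinStep_of_shortExact hS hG hG'⟩

lemma isGorensteinProjective_of_isMonic {F : QuiverRep k V B} (hF : IsMonic F)
    (hF' : ∀ i, IsGorensteinProjective (top F i)) : IsGorensteinProjective F :=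
  isGorensteinProjective_of_class
    (fun F : QuiverRep k V B => IsMonic F ∧ ∀ i, IsGorensteinProjective (top F i))
    (fun _ h => exists_left_of_isMonic h.1 h.2) (fun _ h => exists_right_of_isMonic h.1 h.2)
    ⟨hF, hF'⟩

end MonicWithGorensteinCokernels

/-! ### Tops and vertices of Gorenstein projective representations. -/

section OfGorensteinProjective

/-- Both terms resolving `T` are projective. Ext vanishing against the first lifts `f` to `induced
(vertex T)`, where the defining property of a step extends it; `counit T` brings the extension back
to `T`. -/
lemma IsGorensteinStep.exists_extension_of_pointwise {F P G : QuiverRep k V B} {ι : F ⟶ P}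
    {π : P ⟶ G} (h : IsGorensteinStep ι π) (hF : IsGorensteinProjective F)
    (T : QuiverRep k V B) [∀ i, Projective (vertex T i)] (f : F ⟶ T) :
    ∃ g : P ⟶ T, ι ≫ g = f := by
  have (i : V) : Projective (sourcesObj T i) :=
    projective_biproduct fun α : Quiver.Costar i => vertex T α.1
  obtain ⟨f', hf'⟩ := (hF.extVanishes (induced (sourcesObj T))).exists_lift
    (resolution_shortExact T) f
  obtain ⟨g, hg⟩ := h.extend (induced (vertex T)) inferInstance f'
  exact ⟨g ≫ counit T, by rw [reassoc_of% hg]; exact hf'⟩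

section Top

instance (i j : V) (Q : B) [Projective Q] : Projective (vertex (simple k i Q) j) :=
  projective_biproduct fun _ : PLift (j = i) => Q

lemma incoming_simple {F : QuiverRep k V B} {i : V} {Q : B} (φ : F ⟶ simple k i Q) :
    incoming F i ≫ app φ i = 0 := by
  apply biproduct.hom_ext'
  intro α
  rw [reassoc_of% @ι_incoming, comp_zero]
  exact arrow_app_discrete φ α.2

variable [EnoughProjectives B]

/-- A morphism from the top of `F` to `Q` is a morphism `F ⟶ simple k i Q`, and the latter target is
projective at every vertex, so it extends to `P`. -/
lemma isGorensteinStep_top {F P G : QuiverRep k V B} {ι : F ⟶ P} {π : P ⟶ G}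
    (h : IsGorensteinStep ι π) (hF : IsGorensteinProjective F) (hG : IsMonic G) (i : V) :
    IsGorensteinStep (topMap ι i) (topMap π i) where
  projective := have := h.projective; projective_top P i
  w := topMap_comp_eq_zero (S := ShortComplex.mk ι π h.w) i
  shortExact := top_shortExact h.shortExact hG i
  extend Q _ f := by
    obtain ⟨φ, hφ⟩ := exists_simpleLift (F := F) i (cokernel.π (incoming F i) ≫ f) fun α => by
      rw [← Category.assoc, arrow_π_top, zero_comp]
    obtain ⟨ψ, hψ⟩ := IsGorensteinStep.exists_extension_of_pointwise h hF (simple k i Q) φ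
    refine ⟨cokernel.desc _ (app ψ i ≫ simpleProj k i Q) (by
      rw [← Category.assoc, incoming_simple, zero_comp]), ?_⟩
    rw [← cancel_epi (cokernel.π _), reassoc_of% @π_topMap, cokernel.π_desc, ← reassoc_of% @app_comp, hψ, hφ]

lemma isMonic_of_isGorensteinProjective {F : QuiverRep k V B} (hF : IsGorensteinProjective F) :
    IsMonic F := by
  obtain ⟨P, G, ι, π, -, h⟩ := hF.exists_right
  have := h.projective
  have : Mono ι := h.shortExact.mono_f
  exact (isMonic_of_projective P).of_mono ι

lemma isGorensteinProjective_top {F : QuiverRep k V B} (hF : IsGorensteinProjective F) (i : V) :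
    IsGorensteinProjective (top F i) := by
  refine isGorensteinProjective_of_class
    (fun C : B => ∃ F : QuiverRep k V B, IsGorensteinProjective F ∧ C = top F i) ?_ ?_ ⟨F, hF, rfl⟩
  · rintro _ ⟨F, hF, rfl⟩
    obtain ⟨G, P, ι, π, hG, h⟩ := hF.exists_left
    exact ⟨_, _, _, _, ⟨G, hG, rfl⟩,
      isGorensteinStep_top h hG (isMonic_of_isGorensteinProjective hF) i⟩
  · rintro _ ⟨F, hF, rfl⟩
    obtain ⟨P, G, ι, π, hG, h⟩ := hF.exists_right
    exact ⟨_, _, _, _, ⟨G, hG, rfl⟩,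
      isGorensteinStep_top h hF (isMonic_of_isGorensteinProjective hG) i⟩

end Top

section Vertex

/-- The representation cofreely generated by an object `Q` at the vertex `i`. -/
def coinduced (i : V) (Q : B) : QuiverRep k V B :=
  ofQuiver (fun j => ⨁ fun _ : Quiver.Path j i => Q) fun j l α =>
    biproduct.lift fun p : Quiver.Path l i =>
      biproduct.π (fun _ : Quiver.Path j i => Q) (α.toPath.comp p)

instance (i j : V) (Q : B) [Projective Q] : Projective (vertex (coinduced (k := k) i Q) j) :=
  projective_biproduct fun _ : Quiver.Path j i => Q

variable (k) in
/-- The projection of `coinduced i Q` to the copy of `Q` indexed by a path ending in `i`. -/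
def coinducedπ {i j : V} (p : Quiver.Path j i) (Q : B) : vertex (coinduced (k := k) i Q) j ⟶ Q :=
  biproduct.π (fun _ : Quiver.Path j i => Q) p

lemma coinduced_hom_ext {i j : V} {Q T : B} {f g : T ⟶ vertex (coinduced (k := k) i Q) j}
    (h : ∀ p : Quiver.Path j i, f ≫ coinducedπ k p Q = g ≫ coinducedπ k p Q) : f = g :=
  biproduct.hom_ext (f := fun _ : Quiver.Path j i => Q) _ _ h

/-- A morphism to `coinduced i Q` at a vertex. -/
def coinducedVertexLift {i j : V} {Q T : B} (f : Quiver.Path j i → (T ⟶ Q)) :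
    T ⟶ vertex (coinduced (k := k) i Q) j :=
  (biproduct.lift f : T ⟶ ⨁ fun _ : Quiver.Path j i => Q)

@[simp]
lemma coinducedVertexLift_π {i j : V} {Q T : B} (f : Quiver.Path j i → (T ⟶ Q))
    (p : Quiver.Path j i) : coinducedVertexLift (k := k) f ≫ coinducedπ k p Q = f p :=
  biproduct.lift_π _ _

lemma arrow_coinducedπ {i j l : V} (α : j ⟶ l) (p : Quiver.Path l i) (Q : B) :
    arrow (coinduced i Q) α ≫ coinducedπ k p Q = coinducedπ k (α.toPath.comp p) Q :=
  (arrow_ofQuiver _ _ α =≫ coinducedπ k p Q).trans (biproduct.lift_π _ _)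

/-- Half of the adjunction between evaluation at `i` and `coinduced i`; the component at a path `p`
ending in `i` transports along `p` and applies `f`. -/
lemma exists_coinducedLift {F : QuiverRep k V B} (i : V) {Q : B} (f : vertex F i ⟶ Q) :
    ∃ φ : F ⟶ coinduced i Q, app φ i ≫ coinducedπ k .nil Q = f := by
  refine ⟨homMk (fun j => coinducedVertexLift fun p => pathMap F p ≫ f) fun α =>
    coinduced_hom_ext fun p => ?_, ?_⟩
  · rw [Category.assoc, Category.assoc, coinducedVertexLift_π, arrow_coinducedπ,
      coinducedVertexLift_π, pathMap_comp, pathMap_toPath, Category.assoc]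
  · rw [app_homMk, coinducedVertexLift_π, pathMap_nil, Category.id_comp]

variable [EnoughProjectives B]

/-- The argument for tops with `coinduced i Q`, again vertexwise projective, in place of `simple k i
Q`. -/
lemma isGorensteinStep_vertex {F P G : QuiverRep k V B} {ι : F ⟶ P} {π : P ⟶ G}
    (h : IsGorensteinStep ι π) (hF : IsGorensteinProjective F) (i : V) :
    IsGorensteinStep (app ι i) (app π i) where
  projective := have := h.projective; projective_vertex P i
  w := app_comp_app_eq_zero (ShortComplex.mk ι π h.w) i
  shortExact := app_shortExact h.shortExact i
  extend Q _ f := by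
    obtain ⟨φ, hφ⟩ := exists_coinducedLift i f
    obtain ⟨ψ, hψ⟩ := IsGorensteinStep.exists_extension_of_pointwise h hF (coinduced i Q) φ
    exact ⟨app ψ i ≫ coinducedπ k .nil Q, by rw [← reassoc_of% @app_comp, hψ, hφ]⟩

lemma isGorensteinProjective_vertex {F : QuiverRep k V B} (hF : IsGorensteinProjective F)
    (i : V) : IsGorensteinProjective (vertex F i) := by
  refine isGorensteinProjective_of_class
    (fun C : B => ∃ F : QuiverRep k V B, IsGorensteinProjective F ∧ C = vertex F i) ?_ ?_
    ⟨F, hF, rfl⟩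
  · rintro _ ⟨F, hF, rfl⟩
    obtain ⟨G, P, ι, π, hG, h⟩ := hF.exists_left
    exact ⟨_, _, _, _, ⟨G, hG, rfl⟩, isGorensteinStep_vertex h hG i⟩
  · rintro _ ⟨F, hF, rfl⟩
    obtain ⟨P, G, ι, π, hG, h⟩ := hF.exists_right
    exact ⟨_, _, _, _, ⟨G, hG, rfl⟩, isGorensteinStep_vertex h hF i⟩

end Vertex

end OfGorensteinProjective

end QuiverRep

end

theorem proposition10 {k : Type w} [CommRing k] {V : Type u₁} [Quiver.{v₁} V]
    [LocallyBoundedQuiver V] {B : Type u₂} [Category.{v₂} B] [Abelian B] [Linear k B]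
    [EnoughProjectives B] :
    (∀ F : QuiverRep k V B, IsGorensteinProjective F ↔
      (QuiverRep.IsMonic F ∧
        ∀ i : V, IsGorensteinProjective (cokernel (QuiverRep.incoming F i)))) ∧
    (∀ F : QuiverRep k V B, IsGorensteinProjective F →
      ∀ i : V, IsGorensteinProjective (QuiverRep.vertex F i)) :=
  ⟨fun _ => ⟨fun h => ⟨QuiverRep.isMonic_of_isGorensteinProjective h,
      QuiverRep.isGorensteinProjective_top h⟩,
    fun h => QuiverRep.isGorensteinProjective_of_isMonic h.1 h.2⟩,
   fun _ h => QuiverRep.isGorensteinProjective_vertex h⟩
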